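/- All graphs are finite, simple and undirected. Let $k\ge 1$ be an integer. The odd-girth of a graph is the smallest length of an odd cycle in it ($\infty$ if there is none). A graph $B$ \emph{bounds} $\mathcal{SP}_{2k+1}$ if every $K_4$-minor-free graph of odd-girth at least $2k+1$ admits a homomorphism to $B$. For integers $1\le p,q,r\le k$, let $T_{2k+1}(p,q,r)$ be the graph obtained from three vertices $u,v,w$ by joining $u$ to $v$ by two paths of lengths $p$ and $2k+1-p$, $u$ to $w$ by two paths of lengths $q$ and $2k+1-q$, and $v$ to $w$ by two paths of lengths $r$ and $2k+1-r$, these six paths being pairwise internally disjoint. The triple $\{p,q,r\}$ is \emph{$k$-good} if $T_{2k+1}(p,q,r)$ has odd-girth at least $2k+1$. A \emph{$k$-partial distance graph} of a graph $B$ is a weighted graph $(\widetilde B,d_B)$, where $\widetilde B$ is a graph on the vertex set $V(B)$ such that every edge $xy$ of $\widetilde B$ satisfies $d_B(x,y)\le k$ (vertices in different components of $B$ being at infinite distance), and the weight of the edge $xy$ is the distance $d_B(x,y)$ in $B$. It has the \emph{all $k$-good triple property} if $E(\widetilde B)\neq\emptyset$ and, for every edge $xy$ of $\widetilde B$, with weight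 $p=d_B(x,y)$, and every $k$-good triple $\{p,q,r\}$, there are vertices $z_1,z_2$ such that $xz_1,yz_1,xz_2,yz_2$ are edges of $\widetilde B$ with $d_B(x,z_1)=q$, $d_B(y,z_1)=r$, $d_B(x,z_2)=r$ and $d_B(y,z_2)=q$. \textbf{Theorem.} Let $B$ be a graph of odd-girth $2k+1$. Then $B$ bounds $\mathcal{SP}_{2k+1}$ if and only if there exists a $k$-partial distance graph $(\widetilde B,d_B)$ of $B$ which has the all $k$-good triple property. -/

import Mathlib

universe u v

namespace SimpleGraph

/-- The odd-girth of `G`: the smallest length of an odd cycle of `G`, with value `⊤` if `G` has no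
odd cycle. -/
noncomputable def oddGirth {V : Type u} (G : SimpleGraph V) : ℕ∞ :=
  ⨅ (a : V) (c : G.Walk a a) (_ : c.IsCycle ∧ Odd c.length), (c.length : ℕ∞)

/-- `H` is a minor of `G`: the vertices of `H` are represented by nonempty connected pairwise
disjoint vertex sets (branch sets) of `G`, such that for each edge of `H` there is an edge of `G`
between the corresponding branch sets. -/
def IsMinorOf {W : Type u} {V : Type v} (H : SimpleGraph W) (G : SimpleGraph V) : Prop :=
  ∃ φ : W → Set V,
    (∀ a, (G.induce (φ a)).Connected) ∧
    (∀ a b, a ≠ b → Disjoint (φ a) (φ b)) ∧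
    (∀ a b, H.Adj a b → ∃ x ∈ φ a, ∃ y ∈ φ b, G.Adj x y)

/-- `G` has no `K₄`-minor. -/
def IsK4MinorFree {V : Type u} (G : SimpleGraph V) : Prop :=
  ¬ IsMinorOf (⊤ : SimpleGraph (Fin 4)) G

/-- `B` bounds the class of finite `K₄`-minor-free graphs of odd-girth at least `2k+1`: each of
these graphs admits a homomorphism to `B`. -/
def BoundsSP {V : Type u} (B : SimpleGraph V) (k : ℕ) : Prop :=
  ∀ (W : Type v) [Finite W] (G : SimpleGraph W),
    G.IsK4MinorFree → ((2 * k + 1 : ℕ) : ℕ∞) ≤ G.oddGirth → Nonempty (G →g B)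

/-! ### The graphs `T_{2k+1}(p,q,r)` and good triples

The hubs `u`, `v`, `w` are `0`, `1`, `2` in `Fin 3`. There are six threads, indexed by
`Fin 3 × Bool`: the threads `(0, _)` join `u` to `v`, the threads `(1, _)` join `u` to `w` and the
threads `(2, _)` join `v` to `w`. -/

/-- First endpoint of a thread. -/
def threadFst (e : Fin 3 × Bool) : Fin 3 := ![0, 0, 1] e.1

/-- Second endpoint of a thread. -/
def threadSnd (e : Fin 3 × Bool) : Fin 3 := ![1, 2, 2] e.1

/-- Length of a thread: the pair of threads of index `i` has lengths `ℓ` and `2k+1-ℓ`, where `ℓ` is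
`p`, `q`, `r` for `i = 0, 1, 2`. -/
def threadLen (k p q r : ℕ) (e : Fin 3 × Bool) : ℕ :=
  if e.2 then 2 * k + 1 - ![p, q, r] e.1 else ![p, q, r] e.1

/-- Vertices of `T_{2k+1}(p,q,r)`: the hubs and, for each thread of length `ℓ`, its `ℓ - 1`
internal vertices. -/
abbrev TVertex (k p q r : ℕ) : Type :=
  Fin 3 ⊕ (Σ e : Fin 3 × Bool, Fin (threadLen k p q r e - 1))

/-- The vertex at position `i` (with `0 ≤ i ≤ ℓ`) on a thread of length `ℓ ≥ 1`. -/
def threadPos (k p q r : ℕ) (e : Fin 3 × Bool) (i : ℕ) : TVertex k p q r :=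
  if h₀ : i = 0 then Sum.inl (threadFst e)
  else if h : i < threadLen k p q r e then Sum.inr ⟨e, ⟨i - 1, by omega⟩⟩
  else Sum.inl (threadSnd e)

/-- The graph `T_{2k+1}(p,q,r)` (for `1 ≤ p, q, r ≤ k`): three vertices `u`, `v`, `w`, with `u` and
`v` joined by two internally disjoint paths of lengths `p` and `2k+1-p`, `u` and `w` by two of
lengths `q` and `2k+1-q`, and `v` and `w` by two of lengths `r` and `2k+1-r`. -/
def TGraph (k p q r : ℕ) : SimpleGraph (TVertex k p q r) :=
  SimpleGraph.fromRel fun x y =>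
    ∃ e : Fin 3 × Bool, ∃ i < threadLen k p q r e,
      x = threadPos k p q r e i ∧ y = threadPos k p q r e (i + 1)

/-- The triple `{p, q, r}` of integers between `1` and `k` is `k`-good: `T_{2k+1}(p,q,r)` has
odd-girth at least `2k+1`. -/
def IsGoodTriple (k p q r : ℕ) : Prop :=
  (1 ≤ p ∧ p ≤ k) ∧ (1 ≤ q ∧ q ≤ k) ∧ (1 ≤ r ∧ r ≤ k) ∧
    ((2 * k + 1 : ℕ) : ℕ∞) ≤ (TGraph k p q r).oddGirth

/-! ### Partial distance graphs -/

/-- `(D, d_B)` is a `k`-partial distance graph of `B`: `D` is a graph on the vertex set of `B`, each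
edge `xy` of which has weight `d_B(x, y) ≤ k` (so `x` and `y` are connected in `B`). -/
def IsPartialDistanceGraph {V : Type u} (B D : SimpleGraph V) (k : ℕ) : Prop :=
  ∀ x y, D.Adj x y → B.edist x y ≤ (k : ℕ∞)

/-- The triple `{d_B(x, y), q, r}` is realized on the edge `xy` of `(D, d_B)`: there are vertices
`z₁`, `z₂` joined to `x` and `y` by edges of `(D, d_B)`, of weights `q` and `r` for `z₁`, and of
weights `r` and `q` for `z₂`. -/
def IsRealized {V : Type u} (B D : SimpleGraph V) (x y : V) (q r : ℕ) : Prop :=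
  (∃ z₁, D.Adj x z₁ ∧ D.Adj y z₁ ∧ B.dist x z₁ = q ∧ B.dist y z₁ = r) ∧
  (∃ z₂, D.Adj x z₂ ∧ D.Adj y z₂ ∧ B.dist x z₂ = r ∧ B.dist y z₂ = q)

/-- The all `k`-good triple property of `(D, d_B)`: `D` has an edge, and for each edge `xy` of `D`,
of weight `p`, each `k`-good triple `{p, q, r}` is realized on `xy`. -/
def HasAllGoodTripleProperty {V : Type u} (B D : SimpleGraph V) (k : ℕ) : Prop :=
  D.edgeSet.Nonempty ∧
    ∀ x y, D.Adj x y → ∀ q r, IsGoodTriple k (B.dist x y) q r → IsRealized B D x y q r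

end SimpleGraph

/-! Each weight `p` is written as `halfWeight k a` with `1 ≤ a ≤ k`, so that parallel paths of
lengths `p` and `2k+1-p` become one even path of length `2a` and one odd path of length `2k+1-2a`.
In this parameter `k`-goodness is `IsCompatible`: triangle inequalities and perimeter at most `2k+1`
(`isGoodTriple_of_isCompatible`, `isCompatible_of_isGoodTriple`). The model is half the Hamming
distance on even subsets of a `(2k+1)`-set: all triples of sets are compatible, and every compatible
triple is realised on any pair at the right distance (`exists_halfDist_eq`). Joining sets at
distance `k` gives a graph of odd-girth at least `2k+1`.

Sufficiency: if `G` has odd-girth at least `2k+1`, `medianHalf` weights all pairs of vertices,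
compatibly on every triple, with value `k` on edges. A `K₄`-minor-free graph has a vertex of degree
at most two; contracting it into a neighbour joins its two neighbours, induction maps the rest into
`D`, and a good triple places the removed vertex. Edges of `G` get weight `halfWeight k k = 1`,
hence map to edges of `B`.

Necessity: a universal 2-tree is labelled by even sets so that every compatible triple occurs on
every edge. Its edges of label distance `k` form `labelGraph`, which maps to `B` by compactness.
Ends of a tree edge are joined in `labelGraph` by walks of lengths `2a` and `2k+1-2a`
(`exists_walk_labelGraph`), which fixes the distance of their images in `B`. The images of the tree
edges form `D`. -/

namespace SimpleGraph

/-! ### Odd closed walks and odd-girth -/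

section OddWalks

variable {V : Type*} {G : SimpleGraph V}

theorem Walk.exists_closed_of_getVert_eq {a : V} (c : G.Walk a a) {i j : ℕ} (hij : i ≤ j)
    (hj : j ≤ c.length) (h : c.getVert i = c.getVert j) :
    (∃ (b : V) (d : G.Walk b b), d.length = j - i) ∧
      ∃ (b : V) (d : G.Walk b b), d.length = c.length - (j - i) := by
  refine ⟨⟨_, ((c.drop i).take (j - i)).copy rfl ?_, ?_⟩,
    a, (c.take i).append ((c.drop j).copy h.symm rfl), ?_⟩
  · rw [Walk.drop_getVert, Nat.add_sub_cancel' hij, h]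
  · simp [Walk.length_copy, Walk.take_length, Walk.drop_length]
    omega
  · simp [Walk.length_append, Walk.take_length, Walk.drop_length]
    omega

/-- A repeated vertex splits a closed walk into two shorter closed walks whose lengths add up to the
original, so one of them is odd. Repetitions are sought in the tail, to avoid the trivial
coincidence of the two ends. -/
theorem Walk.exists_isCycle_odd_of_odd (n : ℕ) :
    ∀ {a : V} (c : G.Walk a a), c.length = n → Odd n →
      ∃ (b : V) (d : G.Walk b b), d.IsCycle ∧ Odd d.length ∧ d.length ≤ n := by
  induction n using Nat.strong_induction_on with
  | _ n ih =>
    intro a c hc hn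
    by_cases hp : c.tail.IsPath
    · refine ⟨a, c, Walk.isCycle_iff_isPath_tail_and_le_length.2 ⟨hp, ?_⟩, hc ▸ hn, hc.le⟩
      by_contra hlt
      have h1 : c.length = 1 := by
        obtain ⟨m, hm⟩ := hn
        omega
      exact G.loopless.irrefl a (Walk.adj_of_length_eq_one h1)
    · have hnil : ¬ c.Nil := by
        intro h
        have := Walk.length_eq_zero_iff.2 h
        obtain ⟨m, hm⟩ := hn
        omega
      have hlen := c.length_tail_add_one hnil
      have key : ∃ i j, i < j ∧ j ≤ c.tail.length ∧ c.tail.getVert i = c.tail.getVert j := by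
        by_contra hcon
        push Not at hcon
        refine hp ((Walk.IsPath.getVert_injOn_iff _).1 fun i hi j hj hij => ?_)
        rcases lt_trichotomy i j with hlt | heq | hlt
        · exact absurd hij (hcon i j hlt hj)
        · exact heq
        · exact absurd hij.symm (hcon j i hlt hi)
      obtain ⟨i, j, hij, hj, h⟩ := key
      rw [Walk.getVert_tail, Walk.getVert_tail] at h
      obtain ⟨⟨b, d, hd⟩, b', d', hd'⟩ :=
        c.exists_closed_of_getVert_eq (by omega) (by omega) h
      by_cases hodd : Odd d.length
      · obtain ⟨x, e, he⟩ := ih d.length (by omega) d rfl hodd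
        exact ⟨x, e, he.1, he.2.1, by omega⟩
      · have hodd' : Odd d'.length := by
          rw [Nat.odd_iff] at hn hodd ⊢
          omega
        obtain ⟨x, e, he⟩ := ih d'.length (by omega) d' rfl hodd'
        exact ⟨x, e, he.1, he.2.1, by omega⟩

/-- A lower bound on the odd-girth bounds the lengths of all odd closed walks. -/
theorem le_length_of_le_oddGirth {n : ℕ} (h : (n : ℕ∞) ≤ G.oddGirth) {a : V} (c : G.Walk a a)
    (hc : Odd c.length) : n ≤ c.length := by
  obtain ⟨b, d, hd, hodd, hle⟩ := Walk.exists_isCycle_odd_of_odd _ c rfl hc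
  have h2 : (n : ℕ∞) ≤ d.length :=
    h.trans (iInf_le_of_le b (iInf_le_of_le d (iInf_le_of_le ⟨hd, hodd⟩ le_rfl)))
  exact (Nat.cast_le.1 h2).trans hle

theorem le_oddGirth {n : ℕ} (h : ∀ (a : V) (c : G.Walk a a), Odd c.length → n ≤ c.length) :
    (n : ℕ∞) ≤ G.oddGirth :=
  le_iInf fun a => le_iInf fun c => le_iInf fun hc => Nat.cast_le.2 (h a c hc.2)

end OddWalks

/-! ### Minors under deletion and contraction -/

section Minors

variable {V V' W : Type*} {G : SimpleGraph V} {G' : SimpleGraph V'} {H : SimpleGraph W}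

theorem IsMinorOf.map (h : IsMinorOf H G) (f : G →g G') (hf : Function.Injective f) :
    IsMinorOf H G' := by
  obtain ⟨φ, hc, hd, he⟩ := h
  refine ⟨fun a => f '' φ a, fun a => ?_, fun a b hab => ?_, fun a b hab => ?_⟩
  · let g : G.induce (φ a) →g G'.induce (f '' φ a) :=
      ⟨fun x => ⟨f x, x, x.2, rfl⟩, fun {x y} hxy => f.map_adj hxy⟩
    refine (hc a).map g ?_
    rintro ⟨_, x, hx, rfl⟩
    exact ⟨⟨x, hx⟩, rfl⟩
  · exact (Set.disjoint_image_iff hf).2 (hd a b hab)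
  · obtain ⟨x, hx, y, hy, hxy⟩ := he a b hab
    exact ⟨f x, ⟨x, hx, rfl⟩, f y, ⟨y, hy, rfl⟩, f.map_adj hxy⟩

theorem IsMinorOf.mono {G₁ G₂ : SimpleGraph V} (h : IsMinorOf H G₁) (hle : G₁ ≤ G₂) :
    IsMinorOf H G₂ :=
  h.map (Hom.ofLE hle) fun _ _ h => h

theorem IsK4MinorFree.mono {V : Type*} {G₁ G₂ : SimpleGraph V} (h : G₂.IsK4MinorFree)
    (hle : G₁ ≤ G₂) : G₁.IsK4MinorFree :=
  fun hm => h (hm.mono hle)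

/-- Contraction of `p` into `v`; the vertex `p` becomes isolated. -/
def contractInto (G : SimpleGraph V) (p v : V) : SimpleGraph V where
  Adj a b := a ≠ b ∧ a ≠ p ∧ b ≠ p ∧ (G.Adj a b ∨ a = v ∧ G.Adj p b ∨ b = v ∧ G.Adj p a)
  symm := ⟨fun _ _ h => ⟨h.1.symm, h.2.2.1, h.2.1, by
    rcases h.2.2.2 with h | h | h
    · exact Or.inl h.symm
    · exact Or.inr (Or.inr h)
    · exact Or.inr (Or.inl h)⟩⟩
  loopless := ⟨fun _ h => h.1 rfl⟩

/-- The graph obtained by making the vertex `p` isolated. -/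
def isolate (G : SimpleGraph V) (p : V) : SimpleGraph V where
  Adj a b := G.Adj a b ∧ a ≠ p ∧ b ≠ p
  symm := ⟨fun _ _ h => ⟨h.1.symm, h.2.2, h.2.1⟩⟩
  loopless := ⟨fun a h => G.loopless.irrefl a h.1⟩

theorem isolate_le (G : SimpleGraph V) (p : V) : G.isolate p ≤ G := fun _ _ h => h.1

theorem IsK4MinorFree.contractInto {V : Type*} {G : SimpleGraph V} (h : G.IsK4MinorFree) {p v : V}
    (hpv : G.Adj p v) : (G.contractInto p v).IsK4MinorFree := by
  rintro ⟨φ, hc, hd, he⟩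
  -- `p` is isolated after contraction, so a connected branch set containing it would be `{p}`, with
  -- no edge to the other branch sets.
  have hp : ∀ a, p ∉ φ a := by
    intro a hpa
    obtain ⟨b, hb⟩ := exists_ne a
    obtain ⟨x, hx, y, hy, hxy⟩ := he a b hb.symm
    have hne : (⟨p, hpa⟩ : φ a) ≠ ⟨x, hx⟩ := fun h => hxy.2.1 (congrArg Subtype.val h).symm
    obtain ⟨w⟩ := (hc a).preconnected ⟨p, hpa⟩ ⟨x, hx⟩
    cases w with
    | nil => exact hne rfl
    | cons h _ => exact h.2.1 rfl
  -- Undo the contraction by adding `p` to the branch set containing `v`, if there is one.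
  refine h ⟨fun a => φ a ∪ {q | q = p ∧ v ∈ φ a}, fun a => ?_, fun a b hab => ?_,
    fun a b hab => ?_⟩
  · set S : Set V := φ a ∪ {q | q = p ∧ v ∈ φ a} with hS
    let i : φ a → S := fun x => ⟨x, Or.inl x.2⟩
    have hadj : ∀ x y : φ a, ((G.contractInto p v).induce (φ a)).Adj x y →
        (G.induce S).Reachable (i x) (i y) := by
      rintro ⟨x, hx⟩ ⟨y, hy⟩ hxy
      obtain ⟨hne, hxp, hyp, h | ⟨rfl, h⟩ | ⟨rfl, h⟩⟩ := hxy
      · exact Adj.reachable (show (G.induce S).Adj _ _ from h)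
      · have h1 : (G.induce S).Adj (i ⟨x, hx⟩) ⟨p, Or.inr ⟨rfl, hx⟩⟩ := hpv.symm
        have h2 : (G.induce S).Adj ⟨p, Or.inr ⟨rfl, hx⟩⟩ (i ⟨y, hy⟩) := h
        exact h1.reachable.trans h2.reachable
      · have h1 : (G.induce S).Adj (i ⟨x, hx⟩) ⟨p, Or.inr ⟨rfl, hy⟩⟩ := h.symm
        have h2 : (G.induce S).Adj ⟨p, Or.inr ⟨rfl, hy⟩⟩ (i ⟨y, hy⟩) := hpv
        exact h1.reachable.trans h2.reachable
    have hreach : ∀ x y : φ a, (G.induce S).Reachable (i x) (i y) := by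
      intro x y
      obtain ⟨w⟩ := (hc a).preconnected x y
      induction w with
      | nil => rfl
      | cons h _ ih => exact (hadj _ _ h).trans ih
    obtain ⟨x₀⟩ := (hc a).nonempty
    refine (connected_iff_exists_forall_reachable _).2 ⟨i x₀, ?_⟩
    rintro ⟨y, hy | ⟨rfl, hv⟩⟩
    · exact hreach x₀ ⟨y, hy⟩
    · have h1 : (G.induce S).Adj (i ⟨v, hv⟩) ⟨y, Or.inr ⟨rfl, hv⟩⟩ := hpv.symm
      exact (hreach x₀ ⟨v, hv⟩).trans h1.reachable
  · refine Set.disjoint_left.2 ?_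
    rintro x (hx | ⟨rfl, hx⟩) (hy | ⟨h, hy⟩)
    · exact Set.disjoint_left.1 (hd a b hab) hx hy
    · exact hp a (h ▸ hx)
    · exact hp b hy
    · exact Set.disjoint_left.1 (hd a b hab) hx hy
  · obtain ⟨x, hx, y, hy, hne, hxp, hyp, h | ⟨rfl, h⟩ | ⟨rfl, h⟩⟩ := he a b hab
    · exact ⟨x, Or.inl hx, y, Or.inl hy, h⟩
    · exact ⟨p, Or.inr ⟨rfl, hx⟩, y, Or.inl hy, h⟩
    · exact ⟨x, Or.inl hx, p, Or.inr ⟨rfl, hy⟩, h.symm⟩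

/-- The vertex `p` has at most two neighbours. -/
def IsLow (G : SimpleGraph V) (p : V) : Prop :=
  ∃ x y, ∀ w, G.Adj p w → w = x ∨ w = y

theorem IsLow.of_adj_imp {G₁ G₂ : SimpleGraph V} {p : V} (h : G₁.IsLow p)
    (hle : ∀ w, G₂.Adj p w → G₁.Adj p w) : G₂.IsLow p := by
  obtain ⟨x, y, hxy⟩ := h
  exact ⟨x, y, fun w hw => hxy w (hle w hw)⟩

end Minors

/-! ### Vertices of degree at most two -/

section LowVertices

variable {V : Type*} {G : SimpleGraph V}

theorem adj_and_ne_of_not_isLow {p x y z : V} (hp : ¬ G.IsLow p)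
    (h : ∀ w, G.Adj p w → w = x ∨ w = y ∨ w = z) : G.Adj p x ∧ x ≠ y ∧ x ≠ z := by
  refine ⟨by_contra fun hx => hp ⟨y, z, fun w hw => ?_⟩, ?_, ?_⟩
  · rcases h w hw with rfl | h | h
    · exact absurd hw hx
    · exact Or.inl h
    · exact Or.inr h
  · rintro rfl
    exact hp ⟨x, z, fun w hw => by have := h w hw; tauto⟩
  · rintro rfl
    exact hp ⟨x, y, fun w hw => by have := h w hw; tauto⟩

theorem IsLow.exists_adj {p : V} (hp : G.IsLow p) (hiso : ¬ ∀ w, ¬ G.Adj p w) :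
    ∃ x y, G.Adj p x ∧ (y = x ∨ G.Adj p y) ∧ ∀ w, G.Adj p w → w = x ∨ w = y := by
  obtain ⟨x, y, hxy⟩ := hp
  push Not at hiso
  obtain ⟨w, hw⟩ := hiso
  by_cases hx : G.Adj p x
  · by_cases hy : G.Adj p y
    · exact ⟨x, y, hx, Or.inr hy, hxy⟩
    · refine ⟨x, x, hx, Or.inl rfl, fun z hz => ?_⟩
      rcases hxy z hz with rfl | rfl
      · exact Or.inl rfl
      · exact absurd hz hy
  · refine ⟨y, y, ?_, Or.inl rfl, fun z hz => ?_⟩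
    · rcases hxy w hw with rfl | rfl
      · exact absurd hw hx
      · exact hw
    · rcases hxy z hz with rfl | rfl
      · exact absurd hz hx
      · exact Or.inl rfl

theorem exists_not_adj_of_card_eq_four {S : Finset V} (hS : S.card = 4) (hG : G.IsK4MinorFree) :
    ∃ p ∈ S, ∃ q ∈ S, p ≠ q ∧ ¬ G.Adj p q := by
  by_contra! hcon
  let e : Fin 4 ≃ S := (S.equivFinOfCardEq hS).symm
  refine hG ⟨fun i => {(e i : V)}, fun i => ?_, fun i j hij => ?_, fun i j hij => ?_⟩
  · refine (connected_iff_exists_forall_reachable _).2 ⟨⟨e i, rfl⟩, ?_⟩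
    rintro ⟨_, rfl⟩
    rfl
  · simpa using fun h => hij (e.injective (Subtype.ext h))
  · refine ⟨_, rfl, _, rfl, hcon _ (e i).2 _ (e j).2 fun h => ?_⟩
    exact hij (e.injective (Subtype.ext h))

theorem isLow_of_card_eq_four {S : Finset V} (hS : S.card = 4)
    (hsupp : ∀ a b, G.Adj a b → a ∈ S) {p q : V} (hp : p ∈ S) (hq : q ∈ S) (hpq : p ≠ q)
    (hadj : ¬ G.Adj p q) : G.IsLow p := by
  classical
  have hcard : ((S.erase p).erase q).card = 2 := by
    rw [Finset.card_erase_of_mem (Finset.mem_erase.2 ⟨hpq.symm, hq⟩), Finset.card_erase_of_mem hp,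
      hS]
  obtain ⟨x, y, -, hxy⟩ := Finset.card_eq_two.1 hcard
  refine ⟨x, y, fun w hw => ?_⟩
  have : w ∈ (S.erase p).erase q :=
    Finset.mem_erase.2 ⟨fun h => hadj (h ▸ hw), Finset.mem_erase.2 ⟨hw.ne', hsupp _ _ hw.symm⟩⟩
  simpa [hxy] using this

/-- A `K₄`-minor-free graph with at least four vertices has two nonadjacent vertices of degree at
most two. -/
theorem IsK4MinorFree.exists_not_adj_isLow (n : ℕ) :
    ∀ (S : Finset V) (G : SimpleGraph V), S.card = n + 4 → (∀ a b, G.Adj a b → a ∈ S) →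
      G.IsK4MinorFree → ∃ p ∈ S, ∃ q ∈ S, p ≠ q ∧ ¬ G.Adj p q ∧ G.IsLow p ∧ G.IsLow q := by
  classical
  induction n with
  | zero =>
    intro S G hS hsupp hG
    obtain ⟨p, hp, q, hq, hpq, hadj⟩ := exists_not_adj_of_card_eq_four hS hG
    exact ⟨p, hp, q, hq, hpq, hadj, isLow_of_card_eq_four hS hsupp hp hq hpq hadj,
      isLow_of_card_eq_four hS hsupp hq hp hpq.symm fun h => hadj h.symm⟩
  | succ n ih =>
    intro S G hS hsupp hG
    have herase : ∀ p ∈ S, (S.erase p).card = n + 4 := fun p hp => by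
      rw [Finset.card_erase_of_mem hp, hS]
      rfl
    have ihdel : ∀ p ∈ S, ∃ a ∈ S, ∃ b ∈ S, a ≠ p ∧ b ≠ p ∧ a ≠ b ∧ ¬ G.Adj a b ∧
        (G.isolate p).IsLow a ∧ (G.isolate p).IsLow b := by
      intro p hp
      obtain ⟨a, ha, b, hb, hab, hadj, hla, hlb⟩ := ih (S.erase p) (G.isolate p) (herase p hp)
        (fun a b h => Finset.mem_erase.2 ⟨h.2.1, hsupp a b h.1⟩) (hG.mono (G.isolate_le p))
      rw [Finset.mem_erase] at ha hb
      exact ⟨a, ha.2, b, hb.2, ha.1, hb.1, hab, fun h => hadj ⟨h, ha.1, hb.1⟩, hla, hlb⟩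
    have ihcon : ∀ p v, G.Adj p v → ∃ a ∈ S, ∃ b ∈ S, a ≠ p ∧ b ≠ p ∧ a ≠ b ∧
        ¬ (G.contractInto p v).Adj a b ∧ (G.contractInto p v).IsLow a ∧
        (G.contractInto p v).IsLow b := by
      intro p v hpv
      obtain ⟨a, ha, b, hb, hab, hadj, hla, hlb⟩ := ih (S.erase p) (G.contractInto p v)
        (herase p (hsupp _ _ hpv)) (fun a b h => Finset.mem_erase.2 ⟨h.2.1, by
          rcases h.2.2.2 with h | ⟨rfl, -⟩ | ⟨-, h⟩
          · exact hsupp _ _ h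
          · exact hsupp _ _ hpv.symm
          · exact hsupp _ _ h.symm⟩) (hG.contractInto hpv)
      rw [Finset.mem_erase] at ha hb
      exact ⟨a, ha.2, b, hb.2, ha.1, hb.1, hab, hadj, hla, hlb⟩
    by_cases hlow : ∃ p ∈ S, G.IsLow p
    · obtain ⟨p, hp, hlp⟩ := hlow
      by_cases hiso : ∀ w, ¬ G.Adj p w
      · obtain ⟨a, ha, b, hb, hap, hbp, hab, hadj, hla, hlb⟩ := ihdel p hp
        have hne : ∀ c w, G.Adj c w → w ≠ p := fun c w h hwp => hiso c (hwp ▸ h.symm)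
        exact ⟨a, ha, b, hb, hab, hadj, hla.of_adj_imp fun w h => ⟨h, hap, hne _ _ h⟩,
          hlb.of_adj_imp fun w h => ⟨h, hbp, hne _ _ h⟩⟩
      · obtain ⟨x, y, hx, hy, hxy⟩ := hlp.exists_adj hiso
        -- Contraction makes `x` and `y` adjacent when distinct, so one of the nonadjacent `a`, `b`
        -- lies outside `{x, y}`. That vertex is not a neighbour of `p`, keeps its neighbours, and
        -- pairs with `p`.
        obtain ⟨a, ha, b, hb, hap, hbp, hab, hadj, hla, hlb⟩ := ihcon p x hx
        have hout : ∀ q ∈ S, q ≠ p → q ≠ x → q ≠ y → (G.contractInto p x).IsLow q →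
            ∃ p ∈ S, ∃ q ∈ S, p ≠ q ∧ ¬ G.Adj p q ∧ G.IsLow p ∧ G.IsLow q := by
          intro q hq hqp hqx hqy hlq
          have hnadj : ¬ G.Adj p q := fun h => (hxy q h).elim hqx hqy
          refine ⟨p, hp, q, hq, hqp.symm, hnadj, hlp, hlq.of_adj_imp fun w hw =>
            ⟨hw.ne, hqp, ?_, Or.inl hw⟩⟩
          rintro rfl
          exact hnadj hw.symm
        by_cases h1 : a ≠ x ∧ a ≠ y
        · exact hout a ha hap h1.1 h1.2 hla
        by_cases h2 : b ≠ x ∧ b ≠ y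
        · exact hout b hb hbp h2.1 h2.2 hlb
        exfalso
        have hyx : y ≠ x → G.Adj p y := fun h => hy.resolve_left h
        have hcase : (a = x ∧ b = y) ∨ (a = y ∧ b = x) := by
          by_cases e1 : a = x <;> by_cases e2 : a = y <;> by_cases e3 : b = x <;>
            by_cases e4 : b = y <;> simp_all
        rcases hcase with ⟨rfl, rfl⟩ | ⟨rfl, rfl⟩
        · exact hadj ⟨hab, hap, hbp, Or.inr (Or.inl ⟨rfl, hyx hab.symm⟩)⟩
        · exact hadj ⟨hab, hap, hbp, Or.inr (Or.inr ⟨rfl, hyx hab⟩)⟩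
    · exfalso
      push Not at hlow
      -- With no low vertex, `p` has exactly the neighbours `v`, `s`, `t`. After contraction into
      -- `v`, the two low vertices must be neighbours of `p`, and nonadjacency leaves only `s` and
      -- `t`. Since `s` is not low in `G`, all its possible neighbours, `v` included, are real.
      -- Permuting the roles of `v`, `s`, `t` is then contradictory.
      have key : ∀ p v s t, p ∈ S → (∀ w, G.Adj p w → w = v ∨ w = s ∨ w = t) →
          G.Adj v s ∧ ¬ G.Adj s t := by
        intro p v s t hp hN
        obtain ⟨hv, hvs, hvt⟩ := adj_and_ne_of_not_isLow (hlow p hp) hN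
        obtain ⟨hs, -, hst⟩ := adj_and_ne_of_not_isLow (x := s) (y := v) (z := t) (hlow p hp)
          fun w hw => by have := hN w hw; tauto
        obtain ⟨ht, -, -⟩ := adj_and_ne_of_not_isLow (x := t) (y := v) (z := s) (hlow p hp)
          fun w hw => by have := hN w hw; tauto
        obtain ⟨a, ha, b, hb, hap, hbp, hab, hadj, hla, hlb⟩ := ihcon p v hv
        have hmem : ∀ c ∈ S, c ≠ p → (G.contractInto p v).IsLow c → c = v ∨ c = s ∨ c = t := by
          intro c hc hcp hlc
          by_contra hcon
          refine hlow c hc (hlc.of_adj_imp fun w hw => ⟨hw.ne, hcp, ?_, Or.inl hw⟩)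
          rintro rfl
          exact hcon (hN c hw.symm)
        have hvs' : (G.contractInto p v).Adj v s :=
          ⟨hvs, hv.ne', hs.ne', Or.inr (Or.inl ⟨rfl, hs⟩)⟩
        have hvt' : (G.contractInto p v).Adj v t :=
          ⟨hvt, hv.ne', ht.ne', Or.inr (Or.inl ⟨rfl, ht⟩)⟩
        have hcase : (a = s ∧ b = t) ∨ (a = t ∧ b = s) := by
          rcases hmem a ha hap hla with rfl | rfl | rfl <;>
            rcases hmem b hb hbp hlb with rfl | rfl | rfl
          · exact absurd rfl hab
          · exact absurd hvs' hadj
          · exact absurd hvt' hadj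
          · exact absurd hvs'.symm hadj
          · exact absurd rfl hab
          · exact Or.inl ⟨rfl, rfl⟩
          · exact absurd hvt'.symm hadj
          · exact Or.inr ⟨rfl, rfl⟩
          · exact absurd rfl hab
        have hfin : (G.contractInto p v).IsLow s ∧ ¬ (G.contractInto p v).Adj s t := by
          rcases hcase with ⟨rfl, rfl⟩ | ⟨rfl, rfl⟩
          · exact ⟨hla, hadj⟩
          · exact ⟨hlb, fun h => hadj h.symm⟩
        refine ⟨by_contra fun hnvs => ?_, fun h => hfin.2 ⟨hst, hs.ne', ht.ne', Or.inl h⟩⟩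
        obtain ⟨⟨x, y, hxy⟩, -⟩ := hfin
        have hsub : ∀ w, G.Adj s w → w = p ∨ w = x ∨ w = y := by
          intro w hw
          by_cases hwp : w = p
          · exact Or.inl hwp
          · exact Or.inr (hxy w ⟨hw.ne, hs.ne', hwp, Or.inl hw⟩)
        have hsS : s ∈ S := hsupp _ _ hs.symm
        rcases hxy v hvs'.symm with rfl | rfl
        · exact hnvs (adj_and_ne_of_not_isLow (x := v) (y := p) (z := y) (hlow s hsS)
            fun w hw => by have := hsub w hw; tauto).1.symm
        · exact hnvs (adj_and_ne_of_not_isLow (x := v) (y := p) (z := x) (hlow s hsS)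
            fun w hw => by have := hsub w hw; tauto).1.symm
      obtain ⟨v, hv⟩ : S.Nonempty := Finset.card_pos.1 (by omega)
      -- A vertex that becomes low when `v` is deleted has at most three neighbours in `G`.
      obtain ⟨p, hp, -, -, hpv, -, -, -, ⟨s, t, hst⟩, -⟩ := ihdel v hv
      have hN : ∀ w, G.Adj p w → w = v ∨ w = s ∨ w = t := by
        intro w hw
        by_cases hwv : w = v
        · exact Or.inl hwv
        · exact Or.inr (hst w ⟨hw, hpv, hwv⟩)
      exact (key p s v t hp fun w hw => by have := hN w hw; tauto).2
        (key p v t s hp fun w hw => by have := hN w hw; tauto).1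

/-- A nonempty finite `K₄`-minor-free graph has a vertex of degree at most two. -/
theorem IsK4MinorFree.exists_isLow {S : Finset V} (hS : S.Nonempty)
    (hsupp : ∀ a b, G.Adj a b → a ∈ S) (hG : G.IsK4MinorFree) : ∃ p ∈ S, G.IsLow p := by
  classical
  rcases le_or_gt 4 S.card with h | h
  · obtain ⟨p, hp, -, -, -, -, hl, -⟩ :=
      IsK4MinorFree.exists_not_adj_isLow (S.card - 4) S G (by omega) hsupp hG
    exact ⟨p, hp, hl⟩
  · obtain ⟨p, hp⟩ := hS
    refine ⟨p, hp, ?_⟩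
    have hcard : (S.erase p).card ≤ 2 := by
      rw [Finset.card_erase_of_mem hp]
      omega
    obtain ⟨x, y, hxy⟩ : ∃ x y, S.erase p ⊆ {x, y} := by
      have : (S.erase p).card = 0 ∨ (S.erase p).card = 1 ∨ (S.erase p).card = 2 := by omega
      rcases this with h | h | h
      · exact ⟨p, p, by simp [Finset.card_eq_zero.1 h]⟩
      · obtain ⟨x, hx⟩ := Finset.card_eq_one.1 h
        exact ⟨x, x, by simp [hx]⟩
      · obtain ⟨x, y, -, hx⟩ := Finset.card_eq_two.1 h
        exact ⟨x, y, by simp [hx]⟩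
    exact ⟨x, y, fun w hw => by
      simpa using hxy (Finset.mem_erase.2 ⟨hw.ne', hsupp _ _ hw.symm⟩)⟩

end LowVertices

/-! ### Half-weights and compatible triples -/

/-- The triangle inequalities together with the bound `2k+1` on the perimeter. -/
def IsCompatible (k a b c : ℕ) : Prop :=
  a ≤ b + c ∧ b ≤ a + c ∧ c ≤ a + b ∧ a + b + c ≤ 2 * k + 1

/-- The distance of two vertices joined by walks of lengths `2a` and `2k+1-2a`, in a graph of
odd-girth `2k+1`. -/
def halfWeight (k a : ℕ) : ℕ := min (2 * a) (2 * k + 1 - 2 * a)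

theorem exists_halfWeight_eq {k p : ℕ} (h1 : 1 ≤ p) (h2 : p ≤ k) :
    ∃ a, 1 ≤ a ∧ a ≤ k ∧ p = halfWeight k a := by
  rcases Nat.even_or_odd' p with ⟨m, rfl | rfl⟩
  · exact ⟨m, by omega, by omega, by unfold halfWeight; omega⟩
  · exact ⟨k - m, by omega, by omega, by unfold halfWeight; omega⟩

theorem halfWeight_bounds {k a : ℕ} (h1 : 1 ≤ a) (h2 : a ≤ k) :
    1 ≤ halfWeight k a ∧ halfWeight k a ≤ k := by
  unfold halfWeight
  omega

/-! ### Compatible weightings and odd-girth -/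

section Certificates

variable {V : Type*} {G : SimpleGraph V}

/-- A system of pairwise compatible values which equals `k` on the edges certifies that the
odd-girth is at least `2k+1`. -/
theorem le_oddGirth_of_isCompatible {k : ℕ} (f : V → V → ℕ)
    (hf : ∀ x y z, IsCompatible k (f x y) (f y z) (f x z)) (hself : ∀ x, f x x = 0)
    (hadj : ∀ x y, G.Adj x y → f x y = k) : ((2 * k + 1 : ℕ) : ℕ∞) ≤ G.oddGirth := by
  -- Replacing a step by the pair's value `k` exchanges the two bounds, by a triangle inequality or
  -- by the perimeter bound.
  have key : ∀ {a b : V} (c : G.Walk a b), (c.length % 2 = 0 → 2 * f a b ≤ c.length) ∧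
      (c.length % 2 = 1 → 2 * k + 1 ≤ c.length + 2 * f a b) := by
    intro a b c
    induction c with
    | nil => simp [hself]
    | @cons a d b h c ih =>
      have h1 := hadj _ _ h
      have h2 := hf a d b
      unfold IsCompatible at h2
      rw [Walk.length_cons]
      omega
  refine le_oddGirth fun a c hc => ?_
  have := (key c).2 (Nat.odd_iff.1 hc)
  rw [hself] at this
  omega

/-- Half the smallest length of an even walk, truncated at `k`. -/
noncomputable def evenHalf (G : SimpleGraph V) (k : ℕ) (x y : V) : ℕ :=
  sInf ({m | ∃ c : G.Walk x y, c.length = 2 * m} ∪ {k})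

/-- Half of (the smallest length of an odd walk minus one), truncated at `k`. -/
noncomputable def oddHalf (G : SimpleGraph V) (k : ℕ) (x y : V) : ℕ :=
  sInf ({m | ∃ c : G.Walk x y, c.length = 2 * m + 1} ∪ {k})

theorem evenHalf_cases (k : ℕ) (x y : V) :
    (∃ c : G.Walk x y, c.length = 2 * G.evenHalf k x y) ∨ G.evenHalf k x y = k :=
  Nat.sInf_mem (s := {m | ∃ c : G.Walk x y, c.length = 2 * m} ∪ {k}) ⟨k, Or.inr rfl⟩

theorem oddHalf_cases (k : ℕ) (x y : V) :
    (∃ c : G.Walk x y, c.length = 2 * G.oddHalf k x y + 1) ∨ G.oddHalf k x y = k :=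
  Nat.sInf_mem (s := {m | ∃ c : G.Walk x y, c.length = 2 * m + 1} ∪ {k}) ⟨k, Or.inr rfl⟩

theorem evenHalf_le (k : ℕ) (x y : V) : G.evenHalf k x y ≤ k := Nat.sInf_le (Or.inr rfl)

theorem oddHalf_le (k : ℕ) (x y : V) : G.oddHalf k x y ≤ k := Nat.sInf_le (Or.inr rfl)

theorem evenHalf_le_of_walk {k m : ℕ} {x y : V} (c : G.Walk x y) (hc : c.length = 2 * m) :
    G.evenHalf k x y ≤ m := Nat.sInf_le (Or.inl ⟨c, hc⟩)

theorem oddHalf_le_of_walk {k m : ℕ} {x y : V} (c : G.Walk x y) (hc : c.length = 2 * m + 1) :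
    G.oddHalf k x y ≤ m := Nat.sInf_le (Or.inl ⟨c, hc⟩)

theorem oddHalf_of_adj {k : ℕ} {x y : V} (h : G.Adj x y) : G.oddHalf k x y = 0 :=
  Nat.le_zero.1 (oddHalf_le_of_walk h.toWalk rfl)

theorem one_le_evenHalf {k : ℕ} (hk : 1 ≤ k) {x y : V} (h : x ≠ y) : 1 ≤ G.evenHalf k x y := by
  rcases evenHalf_cases (G := G) k x y with ⟨c, hc⟩ | hc
  · by_contra h0
    exact h (Walk.eq_of_length_eq_zero (p := c) (by omega))
  · omega

theorem evenHalf_comm (k : ℕ) (x y : V) : G.evenHalf k x y = G.evenHalf k y x := by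
  have key : ∀ x y, G.evenHalf k x y ≤ G.evenHalf k y x := by
    intro x y
    rcases evenHalf_cases (G := G) k y x with ⟨c, hc⟩ | hc
    · exact evenHalf_le_of_walk c.reverse (by rw [Walk.length_reverse, hc])
    · exact (evenHalf_le k x y).trans hc.ge
  exact le_antisymm (key x y) (key y x)

theorem oddHalf_comm (k : ℕ) (x y : V) : G.oddHalf k x y = G.oddHalf k y x := by
  have key : ∀ x y, G.oddHalf k x y ≤ G.oddHalf k y x := by
    intro x y
    rcases oddHalf_cases (G := G) k y x with ⟨c, hc⟩ | hc
    · exact oddHalf_le_of_walk c.reverse (by rw [Walk.length_reverse, hc])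
    · exact (oddHalf_le k x y).trans hc.ge
  exact le_antisymm (key x y) (key y x)

theorem evenHalf_le_add (k : ℕ) (x y z : V) :
    G.evenHalf k x z ≤ G.evenHalf k x y + G.evenHalf k y z := by
  have := evenHalf_le (G := G) k x z
  rcases evenHalf_cases (G := G) k x y with ⟨c, hc⟩ | hc
  · rcases evenHalf_cases (G := G) k y z with ⟨d, hd⟩ | hd
    · exact evenHalf_le_of_walk (c.append d) (by rw [Walk.length_append]; omega)
    · omega
  · omega

theorem evenHalf_le_add_oddHalf (k : ℕ) (x y z : V) :
    G.evenHalf k x z ≤ G.oddHalf k x y + G.oddHalf k y z + 1 := by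
  have := evenHalf_le (G := G) k x z
  rcases oddHalf_cases (G := G) k x y with ⟨c, hc⟩ | hc
  · rcases oddHalf_cases (G := G) k y z with ⟨d, hd⟩ | hd
    · exact evenHalf_le_of_walk (c.append d) (by rw [Walk.length_append]; omega)
    · omega
  · omega

theorem oddHalf_le_add (k : ℕ) (x y z : V) :
    G.oddHalf k x z ≤ G.evenHalf k x y + G.oddHalf k y z := by
  have := oddHalf_le (G := G) k x z
  rcases evenHalf_cases (G := G) k x y with ⟨c, hc⟩ | hc
  · rcases oddHalf_cases (G := G) k y z with ⟨d, hd⟩ | hd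
    · exact oddHalf_le_of_walk (c.append d) (by rw [Walk.length_append]; omega)
    · omega
  · omega

theorem le_evenHalf_add_oddHalf {k : ℕ} (hG : ((2 * k + 1 : ℕ) : ℕ∞) ≤ G.oddGirth) (x y : V) :
    k ≤ G.evenHalf k x y + G.oddHalf k x y := by
  rcases evenHalf_cases (G := G) k x y with ⟨c, hc⟩ | hc
  · rcases oddHalf_cases (G := G) k x y with ⟨d, hd⟩ | hd
    · have hlen : (c.append d.reverse).length = 2 * (G.evenHalf k x y + G.oddHalf k x y) + 1 := by
        rw [Walk.length_append, Walk.length_reverse]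
        omega
      have := le_length_of_le_oddGirth hG (c.append d.reverse) ⟨_, hlen⟩
      omega
    · omega
  · omega

/-- The median of `(k+1)/2` and the two bounds imposed by the even and the odd walks. -/
noncomputable def medianHalf (G : SimpleGraph V) (k : ℕ) (x y : V) : ℕ :=
  min (G.evenHalf k x y) (max (k - G.oddHalf k x y) ((k + 1) / 2))

/-- Even walks bound the value above by `a`, odd walks bound it below by `k - b`; the median takes
the point of that interval nearest to `(k+1)/2`. Rounding `k/2` up matters: two such values must sum
to at least `k`, while three must stay within `2k+1`. -/
theorem medianHalf_arith {k a₁ a₂ a₃ b₁ b₂ b₃ : ℕ} (ha₁ : a₁ ≤ k) (hb₁ : k ≤ a₁ + b₁)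
    (hb₂ : k ≤ a₂ + b₂) (hb₃ : k ≤ a₃ + b₃) (h1 : a₁ ≤ a₂ + a₃) (h2 : b₃ ≤ a₂ + b₁)
    (h3 : b₂ ≤ a₃ + b₁) :
    min a₁ (max (k - b₁) ((k + 1) / 2)) ≤
      min a₂ (max (k - b₂) ((k + 1) / 2)) + min a₃ (max (k - b₃) ((k + 1) / 2)) := by
  omega

theorem medianHalf_arith_perimeter {k a₁ a₂ a₃ b₁ b₂ b₃ : ℕ} (hk : 1 ≤ k)
    (ha₁ : a₁ ≤ b₂ + b₃ + 1) (ha₂ : a₂ ≤ b₁ + b₃ + 1) (ha₃ : a₃ ≤ b₁ + b₂ + 1) :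
    min a₁ (max (k - b₁) ((k + 1) / 2)) + min a₂ (max (k - b₂) ((k + 1) / 2)) +
      min a₃ (max (k - b₃) ((k + 1) / 2)) ≤ 2 * k + 1 := by
  omega

theorem isCompatible_medianHalf {k : ℕ} (hk : 1 ≤ k)
    (hG : ((2 * k + 1 : ℕ) : ℕ∞) ≤ G.oddGirth) (x y z : V) :
    IsCompatible k (G.medianHalf k x y) (G.medianHalf k y z) (G.medianHalf k x z) := by
  have e₁ := evenHalf_comm (G := G) k x y
  have e₂ := evenHalf_comm (G := G) k y z
  have e₃ := evenHalf_comm (G := G) k x z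
  have o₁ := oddHalf_comm (G := G) k x y
  have o₂ := oddHalf_comm (G := G) k y z
  have o₃ := oddHalf_comm (G := G) k x z
  have L := le_evenHalf_add_oddHalf hG
  have E := evenHalf_le_add (G := G) k
  have F := evenHalf_le_add_oddHalf (G := G) k
  have O := oddHalf_le_add (G := G) k
  unfold medianHalf
  refine ⟨?_, ?_, ?_, ?_⟩
  · have h1 := E x z y
    have h2 := O z y x
    have h3 := O z x y
    refine medianHalf_arith (evenHalf_le k x y) (L _ _) (L _ _) (L _ _) ?_ ?_ ?_ <;> omega
  · have h1 := E y x z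
    have h2 := O x y z
    have h3 := O x z y
    refine medianHalf_arith (evenHalf_le k y z) (L _ _) (L _ _) (L _ _) ?_ ?_ ?_ <;> omega
  · have h1 := E x y z
    have h2 := O y x z
    have h3 := O y z x
    refine medianHalf_arith (evenHalf_le k x z) (L _ _) (L _ _) (L _ _) ?_ ?_ ?_ <;> omega
  · have h1 := F x z y
    have h2 := F y x z
    have h3 := F x y z
    exact medianHalf_arith_perimeter hk (by omega) (by omega) (by omega)

theorem medianHalf_bounds {k : ℕ} (hk : 1 ≤ k) {x y : V} (h : x ≠ y) :
    1 ≤ G.medianHalf k x y ∧ G.medianHalf k x y ≤ k := by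
  have := one_le_evenHalf (G := G) hk h
  have := evenHalf_le (G := G) k x y
  unfold medianHalf
  omega

theorem medianHalf_comm (k : ℕ) (x y : V) : G.medianHalf k x y = G.medianHalf k y x := by
  rw [medianHalf, medianHalf, evenHalf_comm, oddHalf_comm]

theorem medianHalf_of_adj {k : ℕ} (hk : 1 ≤ k) (hG : ((2 * k + 1 : ℕ) : ℕ∞) ≤ G.oddGirth) {x y : V}
    (h : G.Adj x y) : G.medianHalf k x y = k := by
  have h1 := oddHalf_of_adj (k := k) h
  have h2 := le_evenHalf_add_oddHalf hG x y
  have h3 := evenHalf_le (G := G) k x y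
  unfold medianHalf
  omega

end Certificates

/-! ### Walks forced by the extension property -/

section OddGirthHom

theorem le_oddGirth_of_hom {V V' : Type*} {G : SimpleGraph V} {G' : SimpleGraph V'} {n : ℕ}
    (h : (n : ℕ∞) ≤ G'.oddGirth) (f : G →g G') : (n : ℕ∞) ≤ G.oddGirth :=
  le_oddGirth fun a c hc => by
    simpa using le_length_of_le_oddGirth h (c.map f) (by simpa using hc)

/-- If every pair related by `E` has the extension property for compatible triples, then the pairs
related by `E` are joined by walks of the two lengths that `f` prescribes. -/
theorem exists_walk_of_extension {V : Type*} {G : SimpleGraph V} {k : ℕ} (E : V → V → Prop)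
    (f : V → V → ℕ) (hadj : ∀ x y, E x y → f x y = k → G.Adj x y)
    (hbd : ∀ x y, E x y → 1 ≤ f x y ∧ f x y ≤ k)
    (hext : ∀ x y, E x y → ∀ b c, 1 ≤ b → b ≤ k → 1 ≤ c → c ≤ k → IsCompatible k (f x y) b c →
      ∃ z, E x z ∧ E z y ∧ f x z = b ∧ f z y = c) (n : ℕ) :
    ∀ x y, E x y → n = 2 * f x y ∨ n = 2 * k + 1 - 2 * f x y → ∃ c : G.Walk x y, c.length = n := by
  induction n with
  | zero =>
    intro x y hxy hn
    have := hbd x y hxy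
    omega
  | succ n ih =>
    intro x y hxy hn
    have hb := hbd x y hxy
    by_cases h0 : n = 0
    · exact ⟨(hadj x y hxy (by omega)).toWalk, by simp [h0]⟩
    · obtain ⟨z, hxz, hzy, hf, hn'⟩ : ∃ z, E x z ∧ E z y ∧ f x z = k ∧
          (n = 2 * f z y ∨ n = 2 * k + 1 - 2 * f z y) := by
        rcases hn with hn | hn
        -- Peeling off one edge (value `k`) turns length `2f` into `2k+1-2(k+1-f)`, and in the other
        -- case `2k+1-2f` into `2(k-f)`. The first triple has perimeter exactly `2k+1`, the second
        -- is a degenerate triangle.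
        · obtain ⟨z, h1, h2, h3, h4⟩ := hext x y hxy k (k + 1 - f x y) (by omega) le_rfl (by omega)
            (by omega) ⟨by omega, by omega, by omega, by omega⟩
          exact ⟨z, h1, h2, h3, by omega⟩
        · obtain ⟨z, h1, h2, h3, h4⟩ := hext x y hxy k (k - f x y) (by omega) le_rfl (by omega)
            (by omega) ⟨by omega, by omega, by omega, by omega⟩
          exact ⟨z, h1, h2, h3, by omega⟩
      obtain ⟨c, hc⟩ := ih z y hzy hn'
      exact ⟨Walk.cons (hadj x z hxz hf) c, by simp [hc]⟩

end OddGirthHom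

/-! ### The metric on even subsets -/

section EvenSets

/-- The subsets of even cardinality of a set with `2k+1` elements. -/
abbrev EvenSet (k : ℕ) : Type := {A : Finset (Fin (2 * k + 1)) // Even A.card}

/-- Half the cardinality of the symmetric difference. -/
def halfDist {k : ℕ} (A B : EvenSet k) : ℕ := (symmDiff A.1 B.1).card / 2

theorem card_symmDiff_add {α : Type*} [DecidableEq α] (S T : Finset α) :
    (symmDiff S T).card + 2 * (S ∩ T).card = S.card + T.card := by
  have h1 : (symmDiff S T).card = (S \ T).card + (T \ S).card :=
    Finset.card_union_of_disjoint disjoint_sdiff_sdiff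
  have h2 := Finset.card_sdiff_add_card_inter S T
  have h3 := Finset.card_sdiff_add_card_inter T S
  rw [Finset.inter_comm] at h3
  omega

variable {k : ℕ}

theorem two_mul_halfDist (A B : EvenSet k) : 2 * halfDist A B = (symmDiff A.1 B.1).card := by
  have h := card_symmDiff_add A.1 B.1
  obtain ⟨a, ha⟩ := A.2
  obtain ⟨b, hb⟩ := B.2
  unfold halfDist
  omega

theorem halfDist_self (A : EvenSet k) : halfDist A A = 0 := by
  simp [halfDist]

theorem halfDist_comm (A B : EvenSet k) : halfDist A B = halfDist B A := by
  rw [halfDist, halfDist, symmDiff_comm]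

theorem halfDist_le (A B : EvenSet k) : halfDist A B ≤ k := by
  have h1 := two_mul_halfDist A B
  have h2 := Finset.card_le_univ (symmDiff A.1 B.1)
  rw [Fintype.card_fin] at h2
  omega

theorem one_le_halfDist {A B : EvenSet k} (h : A ≠ B) : 1 ≤ halfDist A B := by
  have h1 := two_mul_halfDist A B
  by_contra h0
  have h2 : (symmDiff A.1 B.1).card = 0 := by omega
  rw [Finset.card_eq_zero, ← Finset.bot_eq_empty, symmDiff_eq_bot] at h2
  exact h (Subtype.ext h2)

/-- Each of the `2k+1` elements lies in either none or exactly two of the three symmetric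
differences, which gives the perimeter bound. -/
theorem isCompatible_halfDist (A B C : EvenSet k) :
    IsCompatible k (halfDist A B) (halfDist B C) (halfDist A C) := by
  have h1 := two_mul_halfDist A B
  have h2 := two_mul_halfDist B C
  have h3 := two_mul_halfDist A C
  rw [← symmDiff_symmDiff_cancel_right B.1 A.1, symmDiff_assoc] at h3
  have h4 := card_symmDiff_add (symmDiff A.1 B.1) (symmDiff B.1 C.1)
  have h5 := Finset.card_union_add_card_inter (symmDiff A.1 B.1) (symmDiff B.1 C.1)
  have h6 := Finset.card_le_univ (symmDiff A.1 B.1 ∪ symmDiff B.1 C.1)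
  have h7 := Finset.card_le_card
    (Finset.inter_subset_left (s₁ := symmDiff A.1 B.1) (s₂ := symmDiff B.1 C.1))
  have h8 := Finset.card_le_card
    (Finset.inter_subset_right (s₁ := symmDiff A.1 B.1) (s₂ := symmDiff B.1 C.1))
  rw [Fintype.card_fin] at h6
  unfold IsCompatible
  omega

theorem exists_halfDist_eq (A B : EvenSet k) {b c : ℕ} (h : IsCompatible k (halfDist A B) b c) :
    ∃ C, halfDist A C = b ∧ halfDist C B = c := by
  obtain ⟨h1, h2, h3, h4⟩ := h
  have hD := two_mul_halfDist A B
  set D := symmDiff A.1 B.1 with hDdef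
  have hDc := Finset.card_add_card_compl D
  rw [Fintype.card_fin] at hDc
  -- `C` is `A` with `I ∪ J` toggled, where `I ⊆ D` and `J ⊆ Dᶜ`. The sizes solve `|I| + |J| = 2b`
  -- and `|D| - |I| + |J| = 2c`; `J` fits in `Dᶜ` by the perimeter bound.
  obtain ⟨I, hI, hIc⟩ := Finset.exists_subset_card_eq
    (show halfDist A B + b - c ≤ D.card by omega)
  obtain ⟨J, hJ, hJc⟩ := Finset.exists_subset_card_eq
    (show b + c - halfDist A B ≤ Dᶜ.card by omega)
  have hdisj : Disjoint I J := Finset.disjoint_left.2 fun x hx hx' =>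
    Finset.mem_compl.1 (hJ hx') (hI hx)
  have hU : (I ∪ J).card = 2 * b := by
    rw [Finset.card_union_of_disjoint hdisj]
    omega
  have hinter : (I ∪ J) ∩ D = I := by
    ext x
    simp only [Finset.mem_inter, Finset.mem_union]
    constructor
    · rintro ⟨hx | hx, hxD⟩
      · exact hx
      · exact absurd hxD (Finset.mem_compl.1 (hJ hx))
    · exact fun hx => ⟨Or.inl hx, hI hx⟩
  have hC := card_symmDiff_add A.1 (I ∪ J)
  have hA := A.2
  let C : EvenSet k := ⟨symmDiff A.1 (I ∪ J), by rw [Nat.even_iff] at hA ⊢; omega⟩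
  have hAC := two_mul_halfDist A C
  have hCB := two_mul_halfDist C B
  have e1 : symmDiff A.1 C.1 = I ∪ J := symmDiff_symmDiff_cancel_left _ _
  have e2 : symmDiff C.1 B.1 = symmDiff (I ∪ J) D := by
    rw [hDdef, ← symmDiff_assoc, symmDiff_comm (I ∪ J) A.1]
  have hS := card_symmDiff_add (I ∪ J) D
  rw [hinter] at hS
  rw [e1] at hAC
  rw [e2] at hCB
  exact ⟨C, by omega, by omega⟩

/-- The graph on the even subsets in which two sets are adjacent when they are at the largest
possible distance. -/
def evenSetGraph (k : ℕ) : SimpleGraph (EvenSet k) where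
  Adj A B := A ≠ B ∧ halfDist A B = k
  symm := ⟨fun _ _ h => ⟨h.1.symm, (halfDist_comm _ _).trans h.2⟩⟩
  loopless := ⟨fun _ h => h.1 rfl⟩

theorem le_oddGirth_evenSetGraph (k : ℕ) : ((2 * k + 1 : ℕ) : ℕ∞) ≤ (evenSetGraph k).oddGirth :=
  le_oddGirth_of_isCompatible halfDist isCompatible_halfDist halfDist_self fun _ _ h => h.2

theorem exists_walk_evenSetGraph {A B : EvenSet k} (hAB : A ≠ B) {n : ℕ}
    (hn : n = 2 * halfDist A B ∨ n = 2 * k + 1 - 2 * halfDist A B) :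
    ∃ c : (evenSetGraph k).Walk A B, c.length = n := by
  refine exists_walk_of_extension (G := evenSetGraph k) (fun A B : EvenSet k => A ≠ B) halfDist (fun A B h h' => ⟨h, h'⟩)
    (fun A B h => ⟨one_le_halfDist h, halfDist_le A B⟩) (fun A B _ b c hb _ hc _ h => ?_) n A B hAB
    hn
  obtain ⟨C, hC, hC'⟩ := exists_halfDist_eq A B h
  refine ⟨C, ?_, ?_, hC, hC'⟩
  · rintro rfl
    rw [halfDist_self] at hC
    omega
  · rintro rfl
    rw [halfDist_self] at hC'
    omega

end EvenSets

/-! ### Walks and homomorphisms of `TGraph` -/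

section Threads

variable {k p q r : ℕ}

/-- A family of walks of the right lengths defines a homomorphism from `T_{2k+1}(p,q,r)`. -/
theorem nonempty_hom_TGraph {V : Type*} {G : SimpleGraph V} (hub : Fin 3 → V)
    (h : ∀ e : Fin 3 × Bool, ∃ c : G.Walk (hub (threadFst e)) (hub (threadSnd e)),
      c.length = threadLen k p q r e) : Nonempty (TGraph k p q r →g G) := by
  choose c hc using h
  let g : TVertex k p q r → V := Sum.elim hub fun s => (c s.1).getVert (s.2 + 1)
  have hg : ∀ e i, i ≤ threadLen k p q r e → g (threadPos k p q r e i) = (c e).getVert i := by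
    intro e i hi
    unfold threadPos
    split_ifs with h0 h1
    · simp [g, h0]
    · have : i - 1 + 1 = i := by omega
      simp [g, this]
    · have : i = (c e).length := by rw [hc]; omega
      simp [g, this]
  have hadj : ∀ e i, i < threadLen k p q r e →
      G.Adj (g (threadPos k p q r e i)) (g (threadPos k p q r e (i + 1))) := by
    intro e i hi
    rw [hg e i hi.le, hg e (i + 1) hi]
    exact (c e).adj_getVert_succ (by rw [hc]; exact hi)
  refine ⟨⟨g, ?_⟩⟩
  rintro x y ⟨-, ⟨e, i, hi, rfl, rfl⟩ | ⟨e, i, hi, rfl, rfl⟩⟩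
  · exact hadj e i hi
  · exact (hadj e i hi).symm

theorem threadFst_ne_threadSnd (e : Fin 3 × Bool) : threadFst e ≠ threadSnd e := by
  obtain ⟨i, b⟩ := e
  fin_cases i <;> simp [threadFst, threadSnd]

theorem TGraph_adj_threadPos (e : Fin 3 × Bool) {i : ℕ} (hi : i < threadLen k p q r e) :
    (TGraph k p q r).Adj (threadPos k p q r e i) (threadPos k p q r e (i + 1)) := by
  refine ⟨?_, Or.inl ⟨e, i, hi, rfl, rfl⟩⟩
  have h2 := threadFst_ne_threadSnd e
  unfold threadPos
  split_ifs <;> simp_all; omega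

theorem exists_walk_TGraph (e : Fin 3 × Bool) (h1 : 1 ≤ threadLen k p q r e) :
    ∃ c : (TGraph k p q r).Walk (Sum.inl (threadFst e)) (Sum.inl (threadSnd e)),
      c.length = threadLen k p q r e := by
  have key : ∀ i, i ≤ threadLen k p q r e →
      ∃ c : (TGraph k p q r).Walk (threadPos k p q r e 0) (threadPos k p q r e i),
        c.length = i := by
    intro i
    induction i with
    | zero => exact fun _ => ⟨Walk.nil, rfl⟩
    | succ i ih =>
      intro hi
      obtain ⟨c, hc⟩ := ih (by omega)
      exact ⟨c.concat (TGraph_adj_threadPos e hi), by simp [hc]⟩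
  obtain ⟨c, hc⟩ := key _ le_rfl
  have e0 : threadPos k p q r e 0 = Sum.inl (threadFst e) := by simp [threadPos]
  have e1 : threadPos k p q r e (threadLen k p q r e) = Sum.inl (threadSnd e) := by
    have : threadLen k p q r e ≠ 0 := by omega
    simp [threadPos, this]
  exact ⟨c.copy e0 e1, by simp [hc]⟩

end Threads

/-! ### Good triples are compatible triples -/

section GoodTriples

variable {k a b c : ℕ}

/-- Three even sets at mutual half-distances `a`, `b`, `c` serve as hubs of a homomorphism from
`TGraph` to `evenSetGraph`, and odd-girth bounds pull back along homomorphisms. -/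
theorem isGoodTriple_of_isCompatible (ha : 1 ≤ a ∧ a ≤ k) (hb : 1 ≤ b ∧ b ≤ k)
    (hc : 1 ≤ c ∧ c ≤ k) (h : IsCompatible k a b c) :
    IsGoodTriple k (halfWeight k a) (halfWeight k b) (halfWeight k c) := by
  refine ⟨halfWeight_bounds ha.1 ha.2, halfWeight_bounds hb.1 hb.2, halfWeight_bounds hc.1 hc.2, ?_⟩
  let A : EvenSet k := ⟨∅, by simp⟩
  obtain ⟨S, -, hS⟩ := Finset.exists_subset_card_eq
    (show 2 * a ≤ (Finset.univ : Finset (Fin (2 * k + 1))).card by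
      rw [Finset.card_univ, Fintype.card_fin]; omega)
  let B : EvenSet k := ⟨S, by rw [hS]; exact even_two_mul a⟩
  have hAB : halfDist A B = a := by
    have := two_mul_halfDist A B
    have e : symmDiff A.1 B.1 = S := by simp [A, B]
    rw [e] at this
    omega
  obtain ⟨C, hAC, hCB⟩ := exists_halfDist_eq A B (hAB.symm ▸ h)
  rw [halfDist_comm] at hCB
  have ne : ∀ {X Y : EvenSet k} {d : ℕ}, halfDist X Y = d → 1 ≤ d → X ≠ Y := by
    rintro X Y d hd h1 rfl
    rw [halfDist_self] at hd
    omega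
  obtain ⟨φ⟩ := nonempty_hom_TGraph (G := evenSetGraph k) (k := k) (p := halfWeight k a)
    (q := halfWeight k b) (r := halfWeight k c) ![A, B, C] (by
      rintro ⟨i, s⟩
      fin_cases i
      · refine exists_walk_evenSetGraph (A := A) (B := B) (ne hAB ha.1) ?_
        cases s <;> simp [threadLen, halfWeight, hAB] <;> omega
      · refine exists_walk_evenSetGraph (A := A) (B := C) (ne hAC hb.1) ?_
        cases s <;> simp [threadLen, halfWeight, hAC] <;> omega
      · refine exists_walk_evenSetGraph (A := B) (B := C) (ne hCB hc.1) ?_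
        cases s <;> simp [threadLen, halfWeight, hCB] <;> omega)
  exact le_oddGirth_of_hom (le_oddGirth_evenSetGraph k) φ

theorem isCompatible_of_isGoodTriple (ha : 1 ≤ a ∧ a ≤ k) (hb : 1 ≤ b ∧ b ≤ k)
    (hc : 1 ≤ c ∧ c ≤ k)
    (h : IsGoodTriple k (halfWeight k a) (halfWeight k b) (halfWeight k c)) :
    IsCompatible k a b c := by
  obtain ⟨-, -, -, h⟩ := h
  set T := TGraph k (halfWeight k a) (halfWeight k b) (halfWeight k c) with hT
  have walks : ∀ (i : Fin 3) (d : ℕ), ![halfWeight k a, halfWeight k b, halfWeight k c] i =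
      halfWeight k d → 1 ≤ d ∧ d ≤ k →
      (∃ w : T.Walk (Sum.inl (![0, 0, 1] i)) (Sum.inl (![1, 2, 2] i)), w.length = 2 * d) ∧
      ∃ w : T.Walk (Sum.inl (![0, 0, 1] i)) (Sum.inl (![1, 2, 2] i)),
        w.length = 2 * k + 1 - 2 * d := by
    intro i d hd hdk
    have hlen : ∀ s : Bool, threadLen k (halfWeight k a) (halfWeight k b) (halfWeight k c) (i, s) =
        if s then 2 * k + 1 - halfWeight k d else halfWeight k d := by
      intro s
      simp [threadLen, hd]
    have hbd := halfWeight_bounds hdk.1 hdk.2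
    obtain ⟨w₁, hw₁⟩ := exists_walk_TGraph (k := k) (p := halfWeight k a) (q := halfWeight k b)
      (r := halfWeight k c) (i, true) (by rw [hlen]; simp; omega)
    obtain ⟨w₂, hw₂⟩ := exists_walk_TGraph (k := k) (p := halfWeight k a) (q := halfWeight k b)
      (r := halfWeight k c) (i, false) (by rw [hlen]; simp; omega)
    rw [hlen] at hw₁ hw₂
    simp only [if_true, Bool.false_eq_true, if_false] at hw₁ hw₂
    unfold halfWeight at hw₁ hw₂
    rcases le_total (2 * d) (2 * k + 1 - 2 * d) with hle | hle
    · exact ⟨⟨w₂, hw₂.trans (by omega)⟩, ⟨w₁, hw₁.trans (by omega)⟩⟩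
    · exact ⟨⟨w₁, hw₁.trans (by omega)⟩, ⟨w₂, hw₂.trans (by omega)⟩⟩
  obtain ⟨⟨a₀, ha₀⟩, a₁, ha₁⟩ := walks 0 a rfl ha
  obtain ⟨⟨b₀, hb₀⟩, b₁, hb₁⟩ := walks 1 b rfl hb
  obtain ⟨⟨c₀, hc₀⟩, c₁, hc₁⟩ := walks 2 c rfl hc
  have close : ∀ (x : T.Walk (Sum.inl 0) (Sum.inl 1)) (y : T.Walk (Sum.inl 0) (Sum.inl 2))
      (z : T.Walk (Sum.inl 1) (Sum.inl 2)) {l m n : ℕ}, x.length = l → y.length = m →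
      z.length = n → (l + n + m) % 2 = 1 → 2 * k + 1 ≤ l + n + m := by
    rintro x y z _ _ _ rfl rfl rfl hodd
    have := le_length_of_le_oddGirth h ((x.append z).append y.reverse) (by
      rw [Walk.length_append, Walk.length_append, Walk.length_reverse]
      exact Nat.odd_iff.2 hodd)
    rwa [Walk.length_append, Walk.length_append, Walk.length_reverse] at this
  -- One odd thread among the three yields a triangle inequality; three odd threads yield the
  -- perimeter bound.
  have i1 := close a₁ b₀ c₀ ha₁ hb₀ hc₀
  have i2 := close a₀ b₁ c₀ ha₀ hb₁ hc₀
  have i3 := close a₀ b₀ c₁ ha₀ hb₀ hc₁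
  have i4 := close a₁ b₁ c₁ ha₁ hb₁ hc₁
  refine ⟨?_, ?_, ?_, ?_⟩ <;> omega

theorem exists_of_isGoodTriple {q r : ℕ} (ha : 1 ≤ a ∧ a ≤ k)
    (h : IsGoodTriple k (halfWeight k a) q r) :
    ∃ b c, (1 ≤ b ∧ b ≤ k) ∧ (1 ≤ c ∧ c ≤ k) ∧ q = halfWeight k b ∧ r = halfWeight k c ∧
      IsCompatible k a b c := by
  obtain ⟨b, hb, hb', rfl⟩ := exists_halfWeight_eq h.2.1.1 h.2.1.2
  obtain ⟨c, hc, hc', rfl⟩ := exists_halfWeight_eq h.2.2.1.1 h.2.2.1.2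
  exact ⟨b, c, ⟨hb, hb'⟩, ⟨hc, hc'⟩, rfl, rfl,
    isCompatible_of_isGoodTriple ha ⟨hb, hb'⟩ ⟨hc, hc'⟩ h⟩

end GoodTriples

/-! ### From good triples to homomorphisms -/

section Sufficiency

variable {V W : Type*} {B D : SimpleGraph V} {k : ℕ}

theorem IsPartialDistanceGraph.dist_bounds (hD : IsPartialDistanceGraph B D k) {x y : V}
    (h : D.Adj x y) : 1 ≤ B.dist x y ∧ B.dist x y ≤ k := by
  have h1 := hD x y h
  have hr : B.Reachable x y := by
    by_contra hcon
    rw [edist_eq_top_of_not_reachable hcon] at h1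
    exact absurd h1 (by simp)
  refine ⟨hr.pos_dist_of_ne h.ne, ?_⟩
  rw [← hr.coe_dist_eq_edist] at h1
  exact Nat.cast_le.1 h1

theorem HasAllGoodTripleProperty.exists_adj_dist_eq (hD : IsPartialDistanceGraph B D k)
    (h : HasAllGoodTripleProperty B D k) {x y : V} (hxy : D.Adj x y) {b : ℕ}
    (hb : 1 ≤ b ∧ b ≤ k) : ∃ z, D.Adj x z ∧ B.dist x z = halfWeight k b := by
  obtain ⟨h1, h2⟩ := hD.dist_bounds hxy
  obtain ⟨a, ha, ha', hp⟩ := exists_halfWeight_eq h1 h2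
  by_cases hab : a = b
  · exact ⟨y, hxy, hab ▸ hp⟩
  -- With truncated subtraction the third side is `|a - b|`, a degenerate triangle; it is positive
  -- as `a ≠ b`.
  · have hgood := isGoodTriple_of_isCompatible (k := k) (a := a) (b := b) (c := (a - b) + (b - a))
      ⟨ha, ha'⟩ hb (by omega) ⟨by omega, by omega, by omega, by omega⟩
    rw [← hp] at hgood
    obtain ⟨⟨z, hxz, -, hd, -⟩, -⟩ := h.2 x y hxy _ _ hgood
    exact ⟨z, hxz, hd⟩

/-- Because `f` is defined and compatible on all pairs, it already weights the edges created by
contraction and stays fixed throughout the induction. That every image has a `D`-neighbour is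
carried along to place vertices with a single neighbour. -/
theorem exists_map_of_hasAllGoodTripleProperty (hD : IsPartialDistanceGraph B D k)
    (h : HasAllGoodTripleProperty B D k) (f : W → W → ℕ)
    (hf : ∀ x y z, IsCompatible k (f x y) (f y z) (f x z)) (hsymm : ∀ x y, f x y = f y x)
    (hbd : ∀ x y, x ≠ y → 1 ≤ f x y ∧ f x y ≤ k) (n : ℕ) :
    ∀ (S : Finset W) (H : SimpleGraph W), S.card = n → (∀ a b, H.Adj a b → a ∈ S) →
      H.IsK4MinorFree → ∃ φ : W → V, (∀ w, ∃ b, D.Adj (φ w) b) ∧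
        ∀ x y, H.Adj x y → D.Adj (φ x) (φ y) ∧ B.dist (φ x) (φ y) = halfWeight k (f x y) := by
  classical
  induction n with
  | zero =>
    intro S H hS hsupp _
    obtain ⟨e, he⟩ := h.1
    induction e using Sym2.ind with
    | _ b₀ b₁ =>
      rw [mem_edgeSet] at he
      refine ⟨fun _ => b₀, fun _ => ⟨b₁, he⟩, fun x y hxy => ?_⟩
      have := hsupp x y hxy
      simp [Finset.card_eq_zero.1 hS] at this
  | succ n ih =>
    intro S H hS hsupp hH
    obtain ⟨p, hp, hlow⟩ := hH.exists_isLow (Finset.card_pos.1 (by omega)) hsupp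
    have hcard : (S.erase p).card = n := by
      rw [Finset.card_erase_of_mem hp, hS]
      rfl
    by_cases hiso : ∀ w, ¬ H.Adj p w
    · obtain ⟨φ, h1, h2⟩ := ih (S.erase p) (H.isolate p) hcard
        (fun a b h => Finset.mem_erase.2 ⟨h.2.1, hsupp a b h.1⟩) (hH.mono (H.isolate_le p))
      refine ⟨φ, h1, fun x y hxy => h2 x y ⟨hxy, ?_, ?_⟩⟩
      · rintro rfl
        exact hiso _ hxy
      · rintro rfl
        exact hiso _ hxy.symm
    · obtain ⟨x, y, hx, hy, hN⟩ := hlow.exists_adj hiso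
      obtain ⟨φ, h1, h2⟩ := ih (S.erase p) (H.contractInto p x) hcard
        (fun a b h => Finset.mem_erase.2 ⟨h.2.1, by
          rcases h.2.2.2 with h | ⟨rfl, -⟩ | ⟨-, h⟩
          · exact hsupp _ _ h
          · exact hsupp _ _ hx.symm
          · exact hsupp _ _ h.symm⟩) (hH.contractInto hx)
      have hz : ∃ z, ∀ w, H.Adj p w →
          D.Adj (φ w) z ∧ B.dist (φ w) z = halfWeight k (f w p) := by
        by_cases hyx : y = x
        · obtain ⟨b, hb⟩ := h1 x
          obtain ⟨z, hz⟩ := h.exists_adj_dist_eq hD hb (hbd x p hx.ne')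
          refine ⟨z, fun w hw => ?_⟩
          obtain rfl : w = x := by have := hN w hw; rw [hyx] at this; tauto
          exact hz
        · have hyp := hy.resolve_left hyx
          obtain ⟨hadj, hdist⟩ := h2 x y
            ⟨Ne.symm hyx, hx.ne', hyp.ne', Or.inr (Or.inl ⟨rfl, hyp⟩)⟩
          have hcomp := hf x y p
          have hgood := isGoodTriple_of_isCompatible (k := k) (hbd x y (Ne.symm hyx))
            (hbd x p hx.ne') (hbd y p hyp.ne') (by unfold IsCompatible at hcomp ⊢; omega)
          rw [← hdist] at hgood
          obtain ⟨⟨z, hxz, hyz, hd, hd'⟩, -⟩ := h.2 _ _ hadj _ _ hgood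
          refine ⟨z, fun w hw => ?_⟩
          rcases hN w hw with rfl | rfl
          · exact ⟨hxz, hd⟩
          · exact ⟨hyz, hd'⟩
      obtain ⟨z, hz⟩ := hz
      refine ⟨Function.update φ p z, fun w => ?_, fun a b hab => ?_⟩
      · by_cases hwp : w = p
        · exact ⟨φ x, by rw [hwp, Function.update_self]; exact (hz x hx).1.symm⟩
        · rw [Function.update_of_ne hwp]
          exact h1 w
      · by_cases hap : a = p
        · subst hap
          rw [Function.update_self, Function.update_of_ne hab.ne', hsymm, dist_comm]
          exact ⟨(hz b hab).1.symm, (hz b hab).2⟩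
        · by_cases hbp : b = p
          · subst hbp
            rw [Function.update_self, Function.update_of_ne hap]
            exact hz a hab.symm
          · rw [Function.update_of_ne hap, Function.update_of_ne hbp]
            exact h2 a b ⟨hab.ne, hap, hbp, Or.inl hab⟩

theorem boundsSP_of_hasAllGoodTripleProperty {V : Type u} {B D : SimpleGraph V} (hk : 1 ≤ k)
    (hD : IsPartialDistanceGraph B D k) (h : HasAllGoodTripleProperty B D k) :
    BoundsSP.{u, v} B k := by
  intro W _ G hG hgirth
  cases nonempty_fintype W
  obtain ⟨φ, -, hφ⟩ := exists_map_of_hasAllGoodTripleProperty hD h (G.medianHalf k)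
    (isCompatible_medianHalf hk hgirth) (medianHalf_comm k) (fun x y => medianHalf_bounds hk) _
    Finset.univ G rfl (fun a _ _ => Finset.mem_univ a) hG
  refine ⟨⟨φ, fun {x y} hxy => ?_⟩⟩
  have := (hφ x y hxy).2
  rw [medianHalf_of_adj hk hgirth hxy] at this
  rw [← dist_eq_one_iff_adj, this]
  unfold halfWeight
  omega

end Sufficiency

/-! ### Restoring a simplicial vertex -/

section SimplicialVertices

variable {V : Type*} {G : SimpleGraph V}

/-- Restoring a vertex of degree at most two whose neighbours form a clique creates no
`K₄`-minor. -/
theorem IsK4MinorFree.of_isolate {z : V} (hlow : G.IsLow z)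
    (hclique : ∀ u v, G.Adj z u → G.Adj z v → u ≠ v → G.Adj u v)
    (h : (G.isolate z).IsK4MinorFree) : G.IsK4MinorFree := by
  classical
  rintro ⟨φ, hc, hd, he⟩
  -- `{z}` cannot be a branch set, as it would need three distinct neighbours. So `z` can be dropped
  -- from its branch set, with a neighbour in that set taking over its adjacencies by the clique
  -- condition.
  have hdisj : ∀ {a b x}, x ∈ φ a → x ∈ φ b → a = b := fun {a b x} hx hy =>
    by_contra fun hab => Set.disjoint_left.1 (hd a b hab) hx hy
  have hne : ∀ a, φ a ≠ {z} := by
    intro a ha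
    have hnb : ∀ b, b ≠ a → ∃ y ∈ φ b, G.Adj z y := by
      intro b hb
      obtain ⟨x, hx, y, hy, hxy⟩ := he a b hb.symm
      rw [ha] at hx
      obtain rfl : x = z := hx
      exact ⟨y, hy, hxy⟩
    obtain ⟨x, y, hxy⟩ := hlow
    have h3 : ∀ a : Fin 4, ∃ b c d, b ≠ a ∧ c ≠ a ∧ d ≠ a ∧ b ≠ c ∧ b ≠ d ∧ c ≠ d := by
      decide
    obtain ⟨b, c, d, hb, hc', hd', hbc, hbd, hcd⟩ := h3 a
    obtain ⟨b', hb', hzb⟩ := hnb b hb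
    obtain ⟨c', hc'', hzc⟩ := hnb c hc'
    obtain ⟨d', hd'', hzd⟩ := hnb d hd'
    rcases hxy _ hzb with rfl | rfl <;> rcases hxy _ hzc with rfl | rfl <;>
      rcases hxy _ hzd with rfl | rfl <;>
      first
        | exact hbc (hdisj hb' hc'')
        | exact hbd (hdisj hb' hd'')
        | exact hcd (hdisj hc'' hd'')
  have hnbr : ∀ a, z ∈ φ a → ∃ x ∈ φ a, G.Adj z x := by
    intro a hza
    obtain ⟨y, hy, hyz⟩ : ∃ y ∈ φ a, y ≠ z := by
      by_contra! hcon
      exact hne a (Set.eq_singleton_iff_unique_mem.2 ⟨hza, hcon⟩)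
    obtain ⟨w⟩ := (hc a).preconnected ⟨z, hza⟩ ⟨y, hy⟩
    cases w with
    | nil => exact absurd rfl hyz
    | @cons _ v _ hadj _ => exact ⟨v, v.2, hadj⟩
  have hstep : ∀ a, ∃ ρ : φ a → (φ a \ {z} : Set V), (∀ u : φ a, (u : V) ≠ z → (ρ u : V) = u) ∧
      (∀ u : φ a, (u : V) = z → G.Adj z (ρ u)) := by
    intro a
    by_cases hza : z ∈ φ a
    · obtain ⟨x, hx, hzx⟩ := hnbr a hza
      refine ⟨fun u => if hu : (u : V) = z then ⟨x, hx, hzx.ne'⟩ else ⟨u, u.2, hu⟩,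
        fun u hu => by simp [hu], fun u hu => by simpa [hu] using hzx⟩
    · exact ⟨fun u => ⟨u, u.2, fun h => hza (h ▸ u.2)⟩, fun u _ => rfl,
        fun u hu => absurd (hu ▸ u.2) hza⟩
  refine h ⟨fun a => φ a \ {z}, fun a => ?_, fun a b hab =>
    (hd a b hab).mono Set.sdiff_subset Set.sdiff_subset, fun a b hab => ?_⟩
  · obtain ⟨ρ, hρ, hρz⟩ := hstep a
    have hreach : ∀ u v : (φ a \ {z} : Set V), (u : V) = v ∨ G.Adj u v →
        ((G.isolate z).induce (φ a \ {z})).Reachable u v := by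
      intro u v huv
      rcases huv with huv | huv
      · rw [Subtype.ext huv]
      · exact Adj.reachable (show ((G.isolate z).induce (φ a \ {z})).Adj u v from ⟨huv, u.2.2, v.2.2⟩)
    have hadj : ∀ u v : φ a, G.Adj u v → ((G.isolate z).induce (φ a \ {z})).Reachable (ρ u) (ρ v) := by
      intro u v huv
      refine hreach _ _ ?_
      by_cases hu : (u : V) = z
      · have hv : (v : V) ≠ z := fun h => huv.ne (hu.trans h.symm)
        rw [hρ v hv]
        by_cases heq : (ρ u : V) = v
        · exact Or.inl heq
        · exact Or.inr (hclique _ _ (hρz u hu) (hu ▸ huv) heq)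
      · rw [hρ u hu]
        by_cases hv : (v : V) = z
        · by_cases heq : (u : V) = ρ v
          · exact Or.inl heq
          · exact Or.inr (hclique _ _ (hv ▸ huv.symm) (hρz v hv) heq)
        · rw [hρ v hv]
          exact Or.inr huv
    have hwalk : ∀ u v : φ a, ((G.isolate z).induce (φ a \ {z})).Reachable (ρ u) (ρ v) := by
      intro u v
      obtain ⟨w⟩ := (hc a).preconnected u v
      induction w with
      | nil => rfl
      | cons h _ ih => exact (hadj _ _ h).trans ih
    obtain ⟨u₀⟩ := (hc a).nonempty
    refine (connected_iff_exists_forall_reachable _).2 ⟨ρ u₀, fun v => ?_⟩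
    have hv : ρ ⟨v, v.2.1⟩ = v := Subtype.ext (hρ ⟨v, v.2.1⟩ v.2.2)
    rw [← hv]
    exact hwalk _ _
  · obtain ⟨x, hx, y, hy, hxy⟩ := he a b hab
    by_cases hxz : x = z
    · subst hxz
      obtain ⟨x', hx', hadj⟩ := hnbr a hx
      have hne' : x' ≠ y := fun h => hab (hdisj hx' (h ▸ hy))
      exact ⟨x', ⟨hx', hadj.ne'⟩, y, ⟨hy, hxy.ne'⟩, hclique _ _ hadj hxy hne', hadj.ne', hxy.ne'⟩
    · by_cases hyz : y = z
      · subst hyz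
        obtain ⟨y', hy', hadj⟩ := hnbr b hy
        have hne' : x ≠ y' := fun h => hab (hdisj (h ▸ hx) hy')
        exact ⟨x, ⟨hx, hxz⟩, y', ⟨hy', hadj.ne'⟩, hclique _ _ hxy.symm hadj hne', hxz, hadj.ne'⟩
      · exact ⟨x, ⟨hx, hxz⟩, y, ⟨hy, hyz⟩, hxy, hxz, hyz⟩

end SimplicialVertices

/-! ### The universal labelled 2-tree -/

/-- The points of the universal `2`-tree labelled by even sets: `new x y C` is a point labelled by
`C` attached to the pair `x`, `y`. -/
inductive TreePoint (k : ℕ) : Type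
  | root : EvenSet k → TreePoint k
  | new : TreePoint k → TreePoint k → EvenSet k → TreePoint k

namespace TreePoint

variable {k : ℕ}

/-- The label of a point. -/
def label : TreePoint k → EvenSet k
  | root A => A
  | new _ _ C => C

/-- The number of nested attachments of a point. -/
def size : TreePoint k → ℕ
  | root _ => 0
  | new x y _ => x.size + y.size + 1

/-- The oriented edges of the universal labelled `2`-tree grown from an edge with ends labelled by
`A` and `B`. -/
inductive Edge (A B : EvenSet k) : TreePoint k → TreePoint k → Prop
  | root : A ≠ B → Edge A B (root A) (root B)
  | left {x y : TreePoint k} {C : EvenSet k} :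
      Edge A B x y → C ≠ x.label → C ≠ y.label → Edge A B (new x y C) x
  | right {x y : TreePoint k} {C : EvenSet k} :
      Edge A B x y → C ≠ x.label → C ≠ y.label → Edge A B (new x y C) y

variable {A B : EvenSet k}

theorem Edge.label_ne {x y : TreePoint k} (h : Edge A B x y) : x.label ≠ y.label := by
  cases h with
  | root h => exact h
  | left _ h _ => exact h
  | right _ _ h => exact h

/-- The universal labelled `2`-tree. -/
def treeGraph (A B : EvenSet k) : SimpleGraph (TreePoint k) where
  Adj x y := Edge A B x y ∨ Edge A B y x
  symm := ⟨fun _ _ h => h.symm⟩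
  loopless := ⟨fun _ h => h.elim (fun h => h.label_ne rfl) fun h => h.label_ne rfl⟩

theorem treeGraph_label_ne {x y : TreePoint k} (h : (treeGraph A B).Adj x y) :
    x.label ≠ y.label :=
  h.elim (fun h => h.label_ne) fun h => h.label_ne.symm

/-- The points of the universal `2`-tree, joined when they are adjacent in it and their labels are
at the largest possible distance. -/
def labelGraph (A B : EvenSet k) : SimpleGraph (TreePoint k) where
  Adj x y := (treeGraph A B).Adj x y ∧ halfDist x.label y.label = k
  symm := ⟨fun _ _ h => ⟨h.1.symm, (halfDist_comm _ _).trans h.2⟩⟩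
  loopless := ⟨fun _ h => h.1.ne rfl⟩

theorem labelGraph_le : labelGraph A B ≤ treeGraph A B := fun _ _ h => h.1

theorem le_oddGirth_labelGraph (A B : EvenSet k) :
    ((2 * k + 1 : ℕ) : ℕ∞) ≤ (labelGraph A B).oddGirth :=
  le_oddGirth_of_hom (le_oddGirth_evenSetGraph k)
    (⟨label, fun h => ⟨treeGraph_label_ne h.1, h.2⟩⟩ : labelGraph A B →g evenSetGraph k)

theorem treeGraph_exists_extension {x y : TreePoint k} (hxy : (treeGraph A B).Adj x y) {b c : ℕ}
    (hb : 1 ≤ b) (hc : 1 ≤ c) (h : IsCompatible k (halfDist x.label y.label) b c) :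
    ∃ z, (treeGraph A B).Adj x z ∧ (treeGraph A B).Adj z y ∧ halfDist x.label z.label = b ∧
      halfDist z.label y.label = c := by
  obtain ⟨C, hC, hC'⟩ := exists_halfDist_eq x.label y.label h
  have h1 : C ≠ x.label := by
    rintro rfl
    rw [halfDist_self] at hC
    omega
  have h2 : C ≠ y.label := by
    rintro rfl
    rw [halfDist_self] at hC'
    omega
  rcases hxy with hxy | hxy
  · exact ⟨new x y C, Or.inr (Edge.left hxy h1 h2), Or.inl (Edge.right hxy h1 h2), hC, hC'⟩
  · exact ⟨new y x C, Or.inr (Edge.right hxy h2 h1), Or.inl (Edge.left hxy h2 h1), hC, hC'⟩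

theorem exists_walk_labelGraph {x y : TreePoint k} (hxy : (treeGraph A B).Adj x y) {n : ℕ}
    (hn : n = 2 * halfDist x.label y.label ∨ n = 2 * k + 1 - 2 * halfDist x.label y.label) :
    ∃ c : (labelGraph A B).Walk x y, c.length = n :=
  exists_walk_of_extension (G := labelGraph A B) (treeGraph A B).Adj
    (fun x y => halfDist x.label y.label) (fun _ _ h h' => ⟨h, h'⟩)
    (fun _ _ h => ⟨one_le_halfDist (treeGraph_label_ne h), halfDist_le _ _⟩)
    (fun _ _ h _ _ hb _ hc _ => treeGraph_exists_extension h hb hc) n x y hxy hn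

theorem Edge.new_inv {x y w : TreePoint k} {C : EvenSet k} (h : Edge A B (new x y C) w) :
    Edge A B x y ∧ (w = x ∨ w = y) := by
  cases h with
  | left h _ _ => exact ⟨h, Or.inl rfl⟩
  | right h _ _ => exact ⟨h, Or.inr rfl⟩

theorem Edge.size_lt_of_new {x y w : TreePoint k} {C : EvenSet k}
    (h : Edge A B w (new x y C)) : (new x y C).size < w.size := by
  cases h <;> simp only [size] <;> omega

theorem Edge.eq_of_root {D : EvenSet k} {w : TreePoint k} (h : Edge A B (TreePoint.root D) w) :
    D = A ∧ w = TreePoint.root B := by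
  cases h
  exact ⟨rfl, rfl⟩

/-- The restriction of the universal `2`-tree to a set of points. -/
def restrict (A B : EvenSet k) (S : Set (TreePoint k)) : SimpleGraph (TreePoint k) where
  Adj x y := (treeGraph A B).Adj x y ∧ x ∈ S ∧ y ∈ S
  symm := ⟨fun _ _ h => ⟨h.1.symm, h.2.2, h.2.1⟩⟩
  loopless := ⟨fun _ h => h.1.ne rfl⟩

/-- A point of maximal size has no later point attached to it, so its neighbours in `S` lie among
the two ends of the edge it was attached to, or are at most the other root. It is therefore
simplicial and can be restored last. -/
theorem isK4MinorFree_restrict (A B : EvenSet k) (S : Finset (TreePoint k)) :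
    (restrict A B S).IsK4MinorFree := by
  classical
  refine Finset.induction_on_max_value size S ?_ ?_
  · rintro ⟨φ, -, -, he⟩
    obtain ⟨x, -, y, -, hxy⟩ := he 0 1 (by simp)
    simpa using hxy.2.1
  · intro z s _ hmax ih
    have hiso : ((restrict A B (insert z s : Finset _)).isolate z).IsK4MinorFree := by
      refine ih.mono fun x y hxy => ⟨hxy.1.1, ?_, ?_⟩
      · simpa [hxy.2.1] using hxy.1.2.1
      · simpa [hxy.2.2] using hxy.1.2.2
    have hsize : ∀ w, (restrict A B (insert z s : Finset _)).Adj z w → w.size ≤ z.size := by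
      intro w hw
      have h := hw.2.2
      rw [Finset.mem_coe, Finset.mem_insert] at h
      exact h.elim (fun h => h ▸ le_rfl) (hmax w)
    have key : ∃ x y, (Edge A B x y ∨ x = y) ∧
        ∀ w, (restrict A B (insert z s : Finset _)).Adj z w → w = x ∨ w = y := by
      cases z with
      | root D =>
        refine ⟨if D = A then root B else root A, _, Or.inr rfl, fun w hw => Or.inl ?_⟩
        have h0 := hsize w hw
        rcases hw.1 with h | h
        · obtain ⟨rfl, rfl⟩ := h.eq_of_root
          simp
        · cases w with
          | new x y C => simp [size] at h0
          | root D' =>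
            obtain ⟨rfl, h'⟩ := h.eq_of_root
            have hne := h.label_ne
            simp only [label] at hne
            simp [hne.symm]
      | new x y C =>
        have hedge : ∀ w, (restrict A B (insert (new x y C) s : Finset _)).Adj (new x y C) w →
            Edge A B x y ∧ (w = x ∨ w = y) := by
          intro w hw
          rcases hw.1 with h | h
          · exact h.new_inv
          · exact absurd h.size_lt_of_new (hsize w hw).not_gt
        by_cases hxy : Edge A B x y
        · exact ⟨x, y, Or.inl hxy, fun w hw => (hedge w hw).2⟩
        · exact ⟨x, x, Or.inr rfl, fun w hw => absurd (hedge w hw).1 hxy⟩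
    obtain ⟨x, y, hxy, hN⟩ := key
    refine hiso.of_isolate ⟨x, y, hN⟩ fun u v hu hv huv => ⟨?_, hu.2.2, hv.2.2⟩
    rcases hxy with hxy | rfl
    · rcases hN u hu with rfl | rfl <;> rcases hN v hv with rfl | rfl
      · exact absurd rfl huv
      · exact Or.inl hxy
      · exact Or.inr hxy
      · exact absurd rfl huv
    · have h1 := hN u hu
      have h2 := hN v hv
      rw [or_self] at h1 h2
      exact absurd (h1.trans h2.symm) huv

end TreePoint

open TreePoint

/-! ### From bounding to good triples -/

section Necessity

/-- Compactness over the finite target `B`: each finite subgraph lies in a finite restriction of the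
2-tree and inherits the odd-girth bound, so it maps to `B`. -/
theorem nonempty_hom_labelGraph {V : Type u} [Finite V] {B : SimpleGraph V} {k : ℕ}
    (h : BoundsSP.{u, v} B k) (A A' : EvenSet k) : Nonempty (labelGraph A A' →g B) := by
  refine nonempty_hom_of_forall_finite_subgraph_hom fun G' hfin => Classical.choice ?_
  have := hfin.to_subtype
  let H : SimpleGraph (ULift.{v} G'.verts) := G'.coe.comap ULift.down
  have hmap : ∀ {x y}, H.Adj x y → (labelGraph A A').Adj x.down y.down := fun h => G'.adj_sub h
  let f : H →g labelGraph A A' := ⟨fun x => x.down, hmap⟩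
  let g : H →g restrict A A' (hfin.toFinset : Set (TreePoint k)) :=
    ⟨fun x => x.down, fun {x y} h => ⟨labelGraph_le (hmap h), by simp, by simp⟩⟩
  have hg : Function.Injective g := fun x y h => ULift.down_injective (Subtype.ext h)
  obtain ⟨φ⟩ := h _ H (fun hm => isK4MinorFree_restrict A A' hfin.toFinset (hm.map g hg))
    (le_oddGirth_of_hom (le_oddGirth_labelGraph A A') f)
  exact ⟨⟨fun x => φ ⟨x⟩, fun {x y} hxy => φ.map_adj (show H.Adj ⟨x⟩ ⟨y⟩ from hxy)⟩⟩

/-- In a graph of odd-girth at least `2k+1`, two walks with lengths of sum `2k+1` determine the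
distance of their ends. -/
theorem dist_eq_halfWeight {V : Type*} {B : SimpleGraph V} {k a : ℕ}
    (hB : ((2 * k + 1 : ℕ) : ℕ∞) ≤ B.oddGirth) (ha : a ≤ k) {x y : V} (c : B.Walk x y)
    (hc : c.length = 2 * a) (d : B.Walk x y) (hd : d.length = 2 * k + 1 - 2 * a) :
    B.dist x y = halfWeight k a := by
  have h1 := dist_le c
  have h2 := dist_le d
  obtain ⟨e, he⟩ := c.reachable.exists_walk_length_eq_dist
  -- A geodesic closes up to an odd closed walk with whichever of the two walks has the other
  -- parity, which bounds it below.
  have key : ∀ c : B.Walk x y, (e.length + c.length) % 2 = 1 →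
      2 * k + 1 ≤ e.length + c.length := by
    intro c hodd
    have hlen : (e.append c.reverse).length = e.length + c.length := by
      rw [Walk.length_append, Walk.length_reverse]
    have := le_length_of_le_oddGirth hB (e.append c.reverse) (by
      rw [hlen]
      exact Nat.odd_iff.2 hodd)
    omega
  have h3 := key c
  have h4 := key d
  unfold halfWeight
  omega

theorem exists_hasAllGoodTripleProperty {V : Type u} [Finite V] {B : SimpleGraph V} {k : ℕ}
    (hk : 1 ≤ k) (hB : ((2 * k + 1 : ℕ) : ℕ∞) ≤ B.oddGirth) (h : BoundsSP.{u, v} B k) :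
    ∃ D : SimpleGraph V, IsPartialDistanceGraph B D k ∧ HasAllGoodTripleProperty B D k := by
  let A : EvenSet k := ⟨∅, by simp⟩
  let A' : EvenSet k := ⟨{⟨0, by omega⟩, ⟨1, by omega⟩}, by
    rw [Finset.card_pair (Fin.ne_of_val_ne zero_ne_one)]
    exact even_two⟩
  have hA : A ≠ A' := fun h => by
    have := congrArg (fun X : EvenSet k => X.1.card) h
    simp [A, A'] at this
  obtain ⟨φ⟩ := nonempty_hom_labelGraph h A A'
  have hbd : ∀ {x y}, (treeGraph A A').Adj x y →
      1 ≤ halfDist x.label y.label ∧ halfDist x.label y.label ≤ k := fun h =>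
    ⟨one_le_halfDist (treeGraph_label_ne h), halfDist_le _ _⟩
  have hwalk : ∀ {x y}, (treeGraph A A').Adj x y → B.Reachable (φ x) (φ y) ∧
      B.dist (φ x) (φ y) = halfWeight k (halfDist x.label y.label) := by
    intro x y hxy
    obtain ⟨c, hc⟩ := exists_walk_labelGraph hxy (Or.inl rfl)
    obtain ⟨d, hd⟩ := exists_walk_labelGraph hxy (Or.inr rfl)
    exact ⟨(c.map φ).reachable, dist_eq_halfWeight hB (hbd hxy).2 (c.map φ) (by simp [hc])
      (d.map φ) (by simp [hd])⟩
  let D : SimpleGraph V :=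
    { Adj := fun b c => ∃ x y, (treeGraph A A').Adj x y ∧ φ x = b ∧ φ y = c
      symm := ⟨fun b c ⟨x, y, h, hb, hc⟩ => ⟨y, x, h.symm, hc, hb⟩⟩
      -- The ends of a tree edge have distinct images, since their distance in `B` is a positive
      -- half-weight.
      loopless := ⟨fun b ⟨x, y, h, hb, hc⟩ => by
        have h1 := (hwalk h).2
        have h2 := halfWeight_bounds (hbd h).1 (hbd h).2
        rw [hb, hc, dist_self] at h1
        omega⟩ }
  refine ⟨D, ?_, ⟨s(φ (root A), φ (root A')), root A, root A', Or.inl (Edge.root hA), rfl, rfl⟩, ?_⟩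
  · rintro _ _ ⟨x, y, hxy, rfl, rfl⟩
    obtain ⟨hr, hd⟩ := hwalk hxy
    rw [← hr.coe_dist_eq_edist, hd]
    exact Nat.cast_le.2 (halfWeight_bounds (hbd hxy).1 (hbd hxy).2).2
  · rintro _ _ ⟨x, y, hxy, rfl, rfl⟩ q r hgood
    rw [(hwalk hxy).2] at hgood
    obtain ⟨b, c, hb, hc, rfl, rfl, hcomp⟩ := exists_of_isGoodTriple (hbd hxy) hgood
    have key : ∀ b c, 1 ≤ b → 1 ≤ c → IsCompatible k (halfDist x.label y.label) b c →
        ∃ z, D.Adj (φ x) z ∧ D.Adj (φ y) z ∧ B.dist (φ x) z = halfWeight k b ∧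
          B.dist (φ y) z = halfWeight k c := by
      intro b c hb hc hcomp
      obtain ⟨z, hxz, hzy, h1, h2⟩ := treeGraph_exists_extension hxy hb hc hcomp
      refine ⟨φ z, ⟨x, z, hxz, rfl, rfl⟩, ⟨y, z, hzy.symm, rfl, rfl⟩, ?_, ?_⟩
      · rw [(hwalk hxz).2, h1]
      · rw [dist_comm, (hwalk hzy).2, h2]
    exact ⟨key b c hb.1 hc.1 hcomp, key c b hc.1 hb.1
      (by unfold IsCompatible at hcomp ⊢; omega)⟩

end Necessity

end SimpleGraph

theorem mainTheorem1 {V : Type u} [Finite V] (B : SimpleGraph V) (k : ℕ) (hk : 1 ≤ k)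
    (hB : B.oddGirth = ((2 * k + 1 : ℕ) : ℕ∞)) :
    SimpleGraph.BoundsSP.{u, v} B k ↔
      ∃ D : SimpleGraph V,
        SimpleGraph.IsPartialDistanceGraph B D k ∧ SimpleGraph.HasAllGoodTripleProperty B D k :=
  ⟨SimpleGraph.exists_hasAllGoodTripleProperty hk hB.ge, fun ⟨_, hD, h⟩ =>
    SimpleGraph.boundsSP_of_hasAllGoodTripleProperty hk hD h⟩
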